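/- Let $\mathbb{K}=\mathbb{R}$ or $\mathbb{C}$, let $p\ge 4$, and let $\mathfrak g$ be a $2p$-dimensional Lie algebra over $\mathbb{K}$ with lower central series $C^0(\mathfrak g)=\mathfrak g$, $C^{j}(\mathfrak g)=[\mathfrak g,C^{j-1}(\mathfrak g)]$. Assume that - $\mathfrak g$ is $2$-step nilpotent: $C^2(\mathfrak g)=0$ and $C^1(\mathfrak g)\neq 0$; - $\mathfrak g$ is symplectic: there is a nondegenerate alternating bilinear form $\theta$ on $\mathfrak g$ with $\theta([X,Y],Z)-\theta([X,Z],Y)+\theta([Y,Z],X)=0$ for all $X,Y,Z\in\mathfrak g$; - the characteristic sequence of $\mathfrak g$ is $(2,2,1,\dots,1)$ (with $2p-4$ ones), where the characteristic sequence is the maximum, in lexicographic order, over all $X\in\mathfrak g\setminus C^1(\mathfrak g)$, of the decreasing sequence of the dimensions of the Jordan blocks of the nilpotent operator $\operatorname{ad}X$. Then $\mathfrak g$ is decomposable, i.e. it is the direct sum of two nonzero ideals, and it is isomorphic to one of $$\mathfrak n_7^{124}\oplus\mathbb K^{2p-7},\quad \mathfrak n_6^{19}\oplus\mathbb K^{2p-6},\quad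 \mathfrak n_6^{20}\oplus\mathbb K^{2p-6},\quad \mathfrak n_5^{5}\oplus\mathbb K^{2p-5},\quad \mathfrak n_3^{1}\oplus\mathfrak n_3^{1}\oplus\mathbb K^{2p-6},$$ or, when $\mathbb K=\mathbb R$, to one of these or to $\mathfrak n_6^{20,1}\oplus\mathbb R^{2p-6}$. Here $\mathbb K^m$ is the abelian Lie algebra of dimension $m$, $\oplus$ is the direct product of Lie algebras, and $\mathfrak n_n^{\ast}$ is the $n$-dimensional Lie algebra with the following Maurer–Cartan equations in the basis dual to $\alpha_1,\dots,\alpha_n$ (with $d\alpha(X,Y)=\alpha([X,Y])$, and $d\alpha_i=0$ for every $i$ not mentioned): - $\mathfrak n_7^{124}$: $d\alpha_3=\alpha_1\wedge\alpha_2+\alpha_4\wedge\alpha_7$, $d\alpha_5=\alpha_1\wedge\alpha_4+\alpha_6\wedge\alpha_7$; - $\mathfrak n_6^{19}$: $d\alpha_3=\alpha_1\wedge\alpha_2$, $d\alpha_5=\alpha_1\wedge\alpha_4+\alpha_2\wedge\alpha_6$; - $\mathfrak n_6^{20}$: $d\alpha_3=\alpha_1\wedge\alpha_2$, $d\alpha_5=\alpha_1\wedge\alpha_4$,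 $d\alpha_6=\alpha_2\wedge\alpha_4$; - $\mathfrak n_6^{20,1}$: $d\alpha_3=\alpha_1\wedge\alpha_2+\alpha_4\wedge\alpha_6$, $d\alpha_5=\alpha_1\wedge\alpha_4-\alpha_2\wedge\alpha_6$; - $\mathfrak n_5^{5}$: $d\alpha_3=\alpha_1\wedge\alpha_2$, $d\alpha_5=\alpha_1\wedge\alpha_4$; - $\mathfrak n_3^{1}$: $d\alpha_3=\alpha_1\wedge\alpha_2$. -/

import Mathlib

namespace SymplecticTwoStep

/-! ### Symplectic forms, 2-step nilpotency, decomposability -/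

section General

variable (K : Type*) [Field K] (L : Type*) [LieRing L] [LieAlgebra K L]

/-- A symplectic form on a Lie algebra: an alternating bilinear form which is nondegenerate and
closed, where `dθ(X, Y, Z) = θ([X, Y], Z) - θ([X, Z], Y) + θ([Y, Z], X)`. -/
structure IsSymplecticForm (θ : LinearMap.BilinForm K L) : Prop where
  alt : θ.IsAlt
  closed : ∀ x y z : L, θ ⁅x, y⁆ z - θ ⁅x, z⁆ y + θ ⁅y, z⁆ x = 0
  nondegenerate : θ.Nondegenerate

/-- The Lie algebra admits a symplectic form. -/
def IsSymplectic : Prop := ∃ θ : LinearMap.BilinForm K L, IsSymplecticForm K L θ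

/-- The Lie algebra is 2-step nilpotent, i.e. nilpotent of nilindex exactly 2:
`C²(L) = 0` and `C¹(L) ≠ 0` for the lower central series `C⁰(L) = L`, `Cʲ(L) = [L, Cʲ⁻¹(L)]`. -/
def IsTwoStepNilpotent : Prop :=
  LieModule.lowerCentralSeries K L L 2 = ⊥ ∧ LieModule.lowerCentralSeries K L L 1 ≠ ⊥

/-- The Lie algebra is the direct sum of two nonzero ideals. -/
def IsDecomposable : Prop :=
  ∃ I J : LieIdeal K L, I ≠ ⊥ ∧ J ≠ ⊥ ∧ IsCompl I J

end General

/-! ### The characteristic sequence -/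

section CharacteristicSequence

variable {K : Type*} [Field K]

/-- `l` is the decreasing sequence of the dimensions of the Jordan blocks of the nilpotent
endomorphism `T`: there is a basis `e i j`, where `i` runs over the positions in `l` and
`0 ≤ j < l i`, with `T (e i j) = e i (j + 1)` if `j + 1 < l i`, and `T (e i j) = 0` otherwise. -/
def HasJordanBlocks {V : Type*} [AddCommGroup V] [Module K V] (T : Module.End K V)
    (l : List ℕ) : Prop :=
  l.Pairwise (fun a b => b ≤ a) ∧ (∀ a ∈ l, 0 < a) ∧
    ∃ e : Module.Basis (Σ i : Fin l.length, Fin (l.get i)) K V,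
      ∀ (i : Fin l.length) (j : Fin (l.get i)),
        T (e ⟨i, j⟩) = if h : (j : ℕ) + 1 < l.get i then e ⟨i, ⟨(j : ℕ) + 1, h⟩⟩ else 0

variable (K)

/-- `c` is the characteristic sequence of the nilpotent Lie algebra `L`: the maximum, for the
lexicographic order (which is the order of `List ℕ`), of the Jordan block sequences of `ad X`
over all `X` in `L` outside `C¹(L)`. -/
def IsCharacteristicSequence (L : Type*) [LieRing L] [LieAlgebra K L] (c : List ℕ) : Prop :=
  IsGreatest {l : List ℕ | ∃ X : L, X ∉ LieModule.lowerCentralSeries K L L 1 ∧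
    HasJordanBlocks (LieAlgebra.ad K L X) l} c

end CharacteristicSequence

/-! ### Lie algebras given by Maurer–Cartan equations -/

/-- Maurer–Cartan equations on `n` forms `α 0, …, α (n - 1)`: the entry `(a, i, j)` of the list
`d k` stands for the term `a • α i ∧ α j` of `dα k`. Only closed forms occur on the
right-hand sides, so that these are the equations of a Lie algebra with central derived algebra. -/
structure MaurerCartan (n : ℕ) where
  d : Fin n → List (ℤ × Fin n × Fin n)
  closed : ∀ k, ∀ t ∈ d k, d t.2.1 = [] ∧ d t.2.2 = []

/-- The underlying space `Kⁿ` of the Lie algebra over `K` with Maurer–Cartan equations `D`; its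
standard basis is dual to the forms `α 0, …, α (n - 1)`. -/
def MCAlg (K : Type*) {n : ℕ} (_D : MaurerCartan n) : Type _ := Fin n → K

namespace MCAlg

variable {K : Type*} [Field K] {n : ℕ} {D : MaurerCartan n}

instance : AddCommGroup (MCAlg K D) := inferInstanceAs (AddCommGroup (Fin n → K))

instance : Module K (MCAlg K D) := inferInstanceAs (Module K (Fin n → K))

/-- The coordinate `α k` of the bracket `[x, y]` is `dα k (x, y)`, where
`(α i ∧ α j) (x, y) = x i * y j - x j * y i`. -/
instance : Bracket (MCAlg K D) (MCAlg K D) where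
  bracket x y := fun k =>
    ((D.d k).map fun t => (t.1 : K) * (x t.2.1 * y t.2.2 - x t.2.2 * y t.2.1)).sum

theorem bracket_apply (x y : MCAlg K D) (k : Fin n) : ⁅x, y⁆ k =
    ((D.d k).map fun t => (t.1 : K) * (x t.2.1 * y t.2.2 - x t.2.2 * y t.2.1)).sum := rfl

theorem add_apply (x y : MCAlg K D) (k : Fin n) : (x + y) k = x k + y k := rfl

theorem smul_apply (a : K) (x : MCAlg K D) (k : Fin n) : (a • x) k = a * x k := rfl

theorem zero_apply (k : Fin n) : (0 : MCAlg K D) k = 0 := rfl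

theorem bracket_apply_of_nil (x y : MCAlg K D) {k : Fin n} (h : D.d k = []) : ⁅x, y⁆ k = 0 := by
  rw [bracket_apply, h]; rfl

theorem bracket_bracket (x y z : MCAlg K D) : ⁅x, ⁅y, z⁆⁆ = 0 := by
  funext k
  rw [bracket_apply, zero_apply]
  apply List.sum_eq_zero
  intro a ha
  obtain ⟨t, ht, rfl⟩ := List.mem_map.1 ha
  obtain ⟨h1, h2⟩ := D.closed k t ht
  rw [bracket_apply_of_nil y z h1, bracket_apply_of_nil y z h2]
  ring

theorem bracket_skew (x y : MCAlg K D) : ⁅x, y⁆ + ⁅y, x⁆ = 0 := by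
  funext k
  rw [add_apply, zero_apply, bracket_apply, bracket_apply, ← List.sum_map_add]
  apply List.sum_eq_zero
  intro a ha
  obtain ⟨t, _, rfl⟩ := List.mem_map.1 ha
  ring

instance : LieRing (MCAlg K D) where
  add_lie x y z := by
    funext k
    rw [add_apply, bracket_apply, bracket_apply, bracket_apply, ← List.sum_map_add]
    refine congrArg List.sum (List.map_congr_left fun t _ => ?_)
    rw [add_apply, add_apply]; ring
  lie_add x y z := by
    funext k
    rw [add_apply, bracket_apply, bracket_apply, bracket_apply, ← List.sum_map_add]
    refine congrArg List.sum (List.map_congr_left fun t _ => ?_)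
    rw [add_apply, add_apply]; ring
  lie_self x := by
    funext k
    rw [bracket_apply, zero_apply]
    apply List.sum_eq_zero
    intro a ha
    obtain ⟨t, _, rfl⟩ := List.mem_map.1 ha
    ring
  leibniz_lie x y z := by
    rw [bracket_bracket, bracket_bracket, add_zero,
      eq_neg_of_add_eq_zero_left (bracket_skew ⁅x, y⁆ z), bracket_bracket, neg_zero]

instance : LieAlgebra K (MCAlg K D) where
  lie_smul a x y := by
    funext k
    rw [smul_apply, bracket_apply, bracket_apply, ← List.sum_map_mul_left]
    refine congrArg List.sum (List.map_congr_left fun t _ => ?_)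
    rw [smul_apply, smul_apply]; ring

end MCAlg

/-! ### The Lie algebras of the classification

The forms are numbered from 0 in the code, so the form `αᵢ` of the comments is number `i - 1`.
All forms whose differential is not mentioned are closed. -/

/-- The abelian Lie algebra `Kᵐ`. -/
def abelian (m : ℕ) : MaurerCartan m := ⟨fun _ => [], by simp⟩

/-- `dα₃ = α₁ ∧ α₂` (the Heisenberg algebra). -/
def n3_1 : MaurerCartan 3 := ⟨![[], [], [(1, 0, 1)]], by decide⟩

/-- `dα₃ = α₁ ∧ α₂`, `dα₅ = α₁ ∧ α₄`. -/
def n5_5 : MaurerCartan 5 := ⟨![[], [], [(1, 0, 1)], [], [(1, 0, 3)]], by decide⟩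

/-- `dα₃ = α₁ ∧ α₂`, `dα₅ = α₁ ∧ α₄ + α₂ ∧ α₆`. -/
def n6_19 : MaurerCartan 6 :=
  ⟨![[], [], [(1, 0, 1)], [], [(1, 0, 3), (1, 1, 5)], []], by decide⟩

/-- `dα₃ = α₁ ∧ α₂`, `dα₅ = α₁ ∧ α₄`, `dα₆ = α₂ ∧ α₄`. -/
def n6_20 : MaurerCartan 6 :=
  ⟨![[], [], [(1, 0, 1)], [], [(1, 0, 3)], [(1, 1, 3)]], by decide⟩

/-- `dα₃ = α₁ ∧ α₂ + α₄ ∧ α₆`, `dα₅ = α₁ ∧ α₄ - α₂ ∧ α₆`. -/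
def n6_20_1 : MaurerCartan 6 :=
  ⟨![[], [], [(1, 0, 1), (1, 3, 5)], [], [(1, 0, 3), (-1, 1, 5)], []], by decide⟩

/-- `dα₃ = α₁ ∧ α₂ + α₄ ∧ α₇`, `dα₅ = α₁ ∧ α₄ + α₆ ∧ α₇`. -/
def n7_124 : MaurerCartan 7 :=
  ⟨![[], [], [(1, 0, 1), (1, 3, 6)], [], [(1, 0, 3), (1, 5, 6)], [], []], by decide⟩

/-- The two Lie algebras over `K` are isomorphic. -/
def Iso (K : Type*) [Field K] (L L' : Type*) [LieRing L] [LieAlgebra K L] [LieRing L']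
    [LieAlgebra K L'] : Prop := Nonempty (L ≃ₗ⁅K⁆ L')

end SymplecticTwoStep

/-!
The characteristic sequence `(2, 2, 1, …, 1)` means that `rank (ad u) ≤ 2` for all `u`, with
equality for some `x`; choose `y`, `z` with `⁅x, y⁆`, `⁅x, z⁆` independent. As the rank cannot drop
in a generic perturbation `ad u + s • ad x`, brackets of elements of the centralizer of `x` lie in
the range of `ad x`, so `C¹` is spanned by `⁅x, y⁆`, `⁅x, z⁆`, `⁅y, z⁆`.

If these three brackets are independent, the rank condition leaves room for nothing but an abelian
complement of the free algebra `n6_20` on `x`, `y`, `z`.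

If `dim C¹ = 2`, let `A₀`, `A₁` be forms that restrict to coordinates on `C¹`. Contracting the
symplectic form with the dual basis of `C¹` gives independent closed forms `α`, `β` with
`dA₀ ∧ α + dA₁ ∧ β = 0`, and Cartan's lemma turns this into `dA₀ = α ∧ μ + β ∧ ν`,
`dA₁ = α ∧ ν + β ∧ ρ`. If `α`, `β`, `μ`, `ν`, `ρ` are independent, this is `n7_124`. Otherwise a
linear relation between them amounts to a binary quadratic form, whose normal forms `X²`, `XY` and,
where `-1` is not a square, `X² + Y²` lead to `n6_19`, `n3_1 ⊕ n3_1` and `n6_20_1`, or to `n5_5` if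
only three independent forms remain: two bivectors in dimension three have a common factor.
-/

namespace SymplecticTwoStep

open Module

section DerivedAlgebra

variable (K : Type*) [CommRing K] (L : Type*) [LieRing L] [LieAlgebra K L]

/-- The derived algebra `C¹(L)`, written as the term of the lower central series that occurs in
`IsTwoStepNilpotent` and `IsCharacteristicSequence`. -/
abbrev derivedAlgebra : LieIdeal K L := LieModule.lowerCentralSeries K L L 1

variable {L}

theorem lie_mem_derivedAlgebra (x y : L) : ⁅x, y⁆ ∈ derivedAlgebra K L :=
  LieSubmodule.lie_mem_lie (LieSubmodule.mem_top x) (LieSubmodule.mem_top y)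

variable {K}

theorem derivedAlgebra_le {W : Submodule K L} (h : ∀ x y : L, ⁅x, y⁆ ∈ W) :
    (derivedAlgebra K L).toSubmodule ≤ W := by
  rw [derivedAlgebra, LieModule.lowerCentralSeries_succ, LieSubmodule.lieIdeal_oper_eq_linear_span',
    Submodule.span_le]
  rintro _ ⟨x, -, y, -, rfl⟩
  exact h x y

theorem lie_eq_zero_of_mem_derivedAlgebra (h : LieModule.lowerCentralSeries K L L 2 = ⊥)
    (x : L) {z : L} (hz : z ∈ derivedAlgebra K L) : ⁅x, z⁆ = 0 := by
  rw [← LieSubmodule.mem_bot (R := K) (L := L), ← h, LieModule.lowerCentralSeries_succ]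
  exact LieSubmodule.lie_mem_lie (LieSubmodule.mem_top x) hz

end DerivedAlgebra

section Forms

variable {K : Type*} [CommRing K] {V : Type*} [AddCommGroup V] [Module K V]

/-- The exterior product `f ∧ g` of two linear forms, as the bilinear form
`(x, y) ↦ f x * g y - g x * f y`. -/
def wedge (f g : Dual K V) : LinearMap.BilinForm K V :=
  LinearMap.BilinForm.linMulLin f g - LinearMap.BilinForm.linMulLin g f

@[simp]
theorem wedge_apply (f g : Dual K V) (x y : V) : wedge f g x y = f x * g y - g x * f y := rfl

@[simp]
theorem wedge_zero (f : Dual K V) : wedge f 0 = 0 := by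
  ext x y
  simp

theorem wedge_neg (f g : Dual K V) : wedge f (-g) = wedge g f := by
  ext x y
  simp only [wedge_apply, LinearMap.neg_apply]
  ring

theorem neg_one_smul_wedge (f g : Dual K V) : (-1 : K) • wedge f g = wedge g f := by
  ext x y
  simp only [wedge_apply, LinearMap.smul_apply, smul_eq_mul]
  ring

variable {L : Type*} [LieRing L] [LieAlgebra K L]

/-- The differential `dφ (x, y) = φ ⁅x, y⁆` of a linear form on a Lie algebra; the sign is that of
the Maurer–Cartan equations of the classification. -/
def differential : Dual K L →ₗ[K] LinearMap.BilinForm K L where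
  toFun φ := (LieModule.toEnd K L L : L →ₗ[K] End K L).compr₂ φ
  map_add' _ _ := rfl
  map_smul' _ _ := rfl

@[simp]
theorem differential_apply (φ : Dual K L) (x y : L) : differential φ x y = φ ⁅x, y⁆ := rfl

theorem apply_eq_zero_of_mem_derivedAlgebra {φ : Dual K L} (hφ : differential φ = 0) {z : L}
    (hz : z ∈ derivedAlgebra K L) : φ z = 0 :=
  derivedAlgebra_le (W := LinearMap.ker φ)
    (fun x y => LinearMap.congr_fun (LinearMap.congr_fun hφ x) y) hz

end Forms

section LinearForms

variable {K : Type*} [Field K] {V : Type*} [AddCommGroup V] [Module K V] {ι : Type*}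

theorem exists_apply_eq_of_linearIndependent [Finite ι] {φ : ι → Dual K V}
    (hφ : LinearIndependent K φ) (c : ι → K) : ∃ x, ∀ i, φ i x = c i := by
  have := FiniteDimensional.span_of_finite K (Set.finite_range φ)
  obtain ⟨x, hx⟩ :=
    (Subspace.quotDualCoannihilatorToDual_bijective
      (Submodule.span K (Set.range φ))).surjective ((Basis.span hφ).constr K c)
  obtain ⟨x, rfl⟩ := Submodule.mkQ_surjective _ x
  refine ⟨x, fun i => ?_⟩
  have := LinearMap.congr_fun hx (Basis.span hφ i)
  rwa [Basis.constr_basis, Basis.span_apply] at this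

theorem exists_dual_apply_eq_of_linearIndependent {v : ι → V} (hv : LinearIndependent K v)
    (c : ι → K) : ∃ φ : Dual K V, ∀ i, φ (v i) = c i := by
  obtain ⟨φ, hφ⟩ := ((Basis.span hv).constr K c).exists_extend
  refine ⟨φ, fun i => ?_⟩
  rw [← Basis.constr_basis (Basis.span hv) K c i, ← hφ, LinearMap.comp_apply,
    Submodule.subtype_apply, Basis.span_apply]

end LinearForms

section DerivedCoordinates

variable {K : Type*} [Field K] {L : Type*} [LieRing L] [LieAlgebra K L] {ι : Type*}

/-- The linear forms `A i` restrict to a linear coordinate system on the derived algebra. -/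
structure IsDerivedCoordinates (A : ι → Dual K L) : Prop where
  eq_zero : ∀ z ∈ derivedAlgebra K L, (∀ i, A i z = 0) → z = 0
  exists_eq : ∀ t : ι → K, ∃ z ∈ derivedAlgebra K L, ∀ i, A i z = t i

theorem exists_isDerivedCoordinates [Finite ι] [DecidableEq ι] {e : ι → L}
    (he : LinearIndependent K e)
    (hspan : Submodule.span K (Set.range e) = (derivedAlgebra K L).toSubmodule) :
    ∃ A : ι → Dual K L, IsDerivedCoordinates A ∧ ∀ i j, A i (e j) = if i = j then 1 else 0 := by
  have := Fintype.ofFinite ι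
  choose A hA using fun i =>
    exists_dual_apply_eq_of_linearIndependent he fun j => if i = j then 1 else 0
  have apply_sum (c : ι → K) (i : ι) : A i (∑ j, c j • e j) = c i := by simp [hA]
  refine ⟨A, ⟨fun z hz h => ?_, fun t => ⟨∑ j, t j • e j, ?_, apply_sum t⟩⟩, hA⟩
  · rw [← LieSubmodule.mem_toSubmodule, ← hspan, Submodule.mem_span_range_iff_exists_fun] at hz
    obtain ⟨c, rfl⟩ := hz
    simp_rw [apply_sum] at h
    simp [h]
  · rw [← LieSubmodule.mem_toSubmodule, ← hspan]
    exact Submodule.sum_mem _ fun j _ => Submodule.smul_mem _ _ (Submodule.subset_span ⟨j, rfl⟩)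

namespace IsDerivedCoordinates

variable {A : ι → Dual K L} (hA : IsDerivedCoordinates A)
include hA

theorem eq_zero_of_differential_eq_zero [Fintype ι] {c : ι → K}
    (hc : differential (∑ i, c i • A i) = 0) : c = 0 := by
  classical
  ext i
  obtain ⟨z, hz, hAz⟩ := hA.exists_eq (Pi.single i 1)
  simpa [LinearMap.sum_apply, hAz, Pi.single_apply] using
    apply_eq_zero_of_mem_derivedAlgebra hc hz

theorem eq_sum [Fintype ι] [DecidableEq ι] {e : ι → L} (he : ∀ i, e i ∈ derivedAlgebra K L)
    (hAe : ∀ i j, A i (e j) = if i = j then 1 else 0) {z : L} (hz : z ∈ derivedAlgebra K L) :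
    z = ∑ i, A i z • e i := by
  rw [← sub_eq_zero]
  refine hA.eq_zero _ (sub_mem hz (sum_mem fun i _ => (derivedAlgebra K L).smul_mem _ (he i)))
    fun i => ?_
  simp [hAe]

theorem exists_apply_eq {κ : Type*} [Finite κ] {ψ : κ → Dual K L} (hψ : LinearIndependent K ψ)
    (hclosed : ∀ k, differential (ψ k) = 0) (s : κ → K) (t : ι → K) :
    ∃ x, (∀ k, ψ k x = s k) ∧ ∀ i, A i x = t i := by
  obtain ⟨x, hx⟩ := exists_apply_eq_of_linearIndependent hψ s
  obtain ⟨z, hz, hz'⟩ := hA.exists_eq fun i => t i - A i x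
  refine ⟨x + z, fun k => ?_, fun i => ?_⟩
  · rw [map_add, hx, apply_eq_zero_of_mem_derivedAlgebra (hclosed k) hz, add_zero]
  · rw [map_add, hz', add_sub_cancel]

end IsDerivedCoordinates

end DerivedCoordinates

namespace MCAlg

variable {K : Type*} [Field K] {n : ℕ}

theorem finrank_eq (D : MaurerCartan n) : finrank K (MCAlg K D) = n :=
  finrank_fin_fun K

instance (D : MaurerCartan n) : FiniteDimensional K (MCAlg K D) :=
  inferInstanceAs (FiniteDimensional K (Fin n → K))

instance [NeZero n] (D : MaurerCartan n) : Nontrivial (MCAlg K D) :=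
  inferInstanceAs (Nontrivial (Fin n → K))

theorem abelian_bracket (x y : MCAlg K (abelian n)) : ⁅x, y⁆ = 0 :=
  funext fun _ => bracket_apply_of_nil x y rfl

variable {L : Type*} [LieRing L] [LieAlgebra K L]

theorem sum_smul_wedge_apply (φ : Fin n → Dual K L) (l : List (ℤ × Fin n × Fin n)) (x y : L) :
    (l.map fun t => (t.1 : K) • wedge (φ t.2.1) (φ t.2.2)).sum x y =
      (l.map fun t => (t.1 : K) * (φ t.2.1 x * φ t.2.2 y - φ t.2.2 x * φ t.2.1 y)).sum := by
  induction l with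
  | nil => rfl
  | cons t l ih =>
    simp only [List.map_cons, List.sum_cons, LinearMap.add_apply, LinearMap.smul_apply, ih,
      wedge_apply, smul_eq_mul]

/-- The homomorphism to the Lie algebra with Maurer–Cartan equations `D` whose coordinates are
linear forms on `L` that satisfy these equations. -/
def lift (D : MaurerCartan n) (φ : Fin n → Dual K L)
    (h : ∀ k, differential (φ k) =
      ((D.d k).map fun t => (t.1 : K) • wedge (φ t.2.1) (φ t.2.2)).sum) : L →ₗ⁅K⁆ MCAlg K D where
  toFun x k := φ k x
  map_add' x y := funext fun k => map_add (φ k) x y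
  map_smul' a x := funext fun k => map_smul (φ k) a x
  map_lie' {x y} := funext fun k =>
    (LinearMap.congr_fun (LinearMap.congr_fun (h k) x) y).trans (sum_smul_wedge_apply φ _ x y)

end MCAlg

section IsoCriteria

variable {K : Type*} [Field K] {L : Type*} [LieRing L] [LieAlgebra K L]
  {M : Type*} [LieRing M] [LieAlgebra K M] {N : Type*} [LieRing N] [LieAlgebra K N]

theorem ker_ne_top_of_surjective [Nontrivial M] {f : L →ₗ⁅K⁆ M} (hf : Function.Surjective f) :
    f.ker ≠ ⊤ := fun htop => by
  obtain ⟨b, hb⟩ := exists_ne (0 : M)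
  obtain ⟨x, rfl⟩ := hf b
  exact hb (f.mem_ker.1 (htop ▸ LieSubmodule.mem_top x))

theorem isDecomposable_of_isCompl_ker [Nontrivial M] [Nontrivial N] {f : L →ₗ⁅K⁆ M}
    {g : L →ₗ⁅K⁆ N} (hf : Function.Surjective f) (hg : Function.Surjective g)
    (h : IsCompl f.ker g.ker) : IsDecomposable K L := by
  refine ⟨f.ker, g.ker, fun hbot => ?_, fun hbot => ?_, h⟩
  · exact ker_ne_top_of_surjective hg (eq_top_of_bot_isCompl (hbot ▸ h))
  · exact ker_ne_top_of_surjective hf (eq_top_of_isCompl_bot (hbot ▸ h))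

theorem isDecomposable_of_iso_prod [Nontrivial M] [Nontrivial N] (h : Iso K L (M × N)) :
    IsDecomposable K L := by
  obtain ⟨e⟩ := h
  refine isDecomposable_of_isCompl_ker (f := (LieHom.fst K M N).comp (e : L →ₗ⁅K⁆ M × N))
    (g := (LieHom.snd K M N).comp (e : L →ₗ⁅K⁆ M × N))
    (Prod.fst_surjective.comp e.surjective)
    (Prod.snd_surjective.comp e.surjective) ?_
  rw [← LieSubmodule.isCompl_toSubmodule]
  have hcompl := (LinearMap.isCompl_range_inl_inr (R := K) (M := M) (M₂ := N)).symm
  rw [← LinearMap.ker_fst, ← LinearMap.ker_snd] at hcompl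
  exact (Submodule.orderIsoMapComap e.toLinearEquiv).symm.isCompl hcompl

variable [FiniteDimensional K L]

theorem iso_prod_abelian_of_surjective (φ : L →ₗ⁅K⁆ M) (hφ : Function.Surjective φ)
    (hinj : ∀ z ∈ derivedAlgebra K L, φ z = 0 → z = 0) :
    Iso K L (M × MCAlg K (abelian (finrank K L - finrank K M))) := by
  have hdisj : Disjoint (derivedAlgebra K L).toSubmodule (LinearMap.ker (φ : L →ₗ[K] M)) :=
    Submodule.disjoint_def.2 hinj
  obtain ⟨C, hC, hcompl⟩ := hdisj.exists_isCompl
  have hrange : LinearMap.range (φ : L →ₗ[K] M) = ⊤ := LinearMap.range_eq_top.2 hφ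
  have hrank := (φ : L →ₗ[K] M).finrank_range_add_finrank_ker
  rw [hrange, finrank_top] at hrank
  let e : LinearMap.ker (φ : L →ₗ[K] M) ≃ₗ[K] MCAlg K (abelian (finrank K L - finrank K M)) :=
    LinearEquiv.ofFinrankEq _ _ (by rw [MCAlg.finrank_eq]; omega)
  let ψ : L →ₗ[K] MCAlg K (abelian (finrank K L - finrank K M)) :=
    e.toLinearMap ∘ₗ Submodule.projectionOnto _ C hcompl.symm
  have ker_ψ : LinearMap.ker ψ = C := by
    rw [LinearEquiv.ker_comp, Submodule.ker_projectionOnto]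
  have range_ψ : LinearMap.range ψ = ⊤ := LinearMap.range_eq_top.2
    (e.surjective.comp (Submodule.projectionOnto_surjective hcompl.symm))
  refine ⟨{ LinearMap.equivProdOfSurjectiveOfIsCompl (φ : L →ₗ[K] M) ψ hrange range_ψ
    (ker_ψ.symm ▸ hcompl.symm) with map_lie' := fun {x y} => ?_ }⟩
  have hψ : ψ ⁅x, y⁆ = 0 :=
    LinearMap.mem_ker.1 (ker_ψ.symm ▸ hC (lie_mem_derivedAlgebra K x y))
  change (φ ⁅x, y⁆, ψ ⁅x, y⁆) = (⁅φ x, φ y⁆, ⁅ψ x, ψ y⁆)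
  rw [φ.map_lie, hψ, MCAlg.abelian_bracket]

theorem iso_of_maurerCartan {n : ℕ} (D : MaurerCartan n) {φ : Fin n → Dual K L}
    (hφ : ∀ k, differential (φ k) =
      ((D.d k).map fun t => (t.1 : K) • wedge (φ t.2.1) (φ t.2.2)).sum)
    (hsurj : ∀ c : Fin n → K, ∃ x, ∀ k, φ k x = c k)
    (hinj : ∀ z ∈ derivedAlgebra K L, (∀ k, φ k z = 0) → z = 0) :
    Iso K L (MCAlg K D × MCAlg K (abelian (finrank K L - n))) := by
  have h := iso_prod_abelian_of_surjective (MCAlg.lift D φ hφ)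
    (fun c => (hsurj c).imp fun x hx => funext hx) fun z hz h0 => hinj z hz (congrFun h0)
  rwa [MCAlg.finrank_eq] at h

end IsoCriteria

section CommonFactor

open Matrix

variable {K : Type*} [Field K] {V : Type*} [AddCommGroup V] [Module K V]

theorem linearIndependent_of_wedge_ne_zero {f g h : Dual K V}
    (hli : ∀ s t : K, wedge f (s • g + t • h) = 0 → s = 0 ∧ t = 0) :
    LinearIndependent K ![f, g, h] := by
  rw [Fintype.linearIndependent_iff]
  intro c hc
  simp only [Fin.sum_univ_three, cons_val_zero, cons_val_one, cons_val] at hc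
  have sum_apply (x : V) : c 0 * f x + c 1 * g x + c 2 * h x = 0 := LinearMap.congr_fun hc x
  obtain ⟨h1, h2⟩ := hli (c 1) (c 2) (by
    ext x y
    simp only [wedge_apply, LinearMap.add_apply, LinearMap.smul_apply, smul_eq_mul,
      LinearMap.zero_apply]
    linear_combination f x * sum_apply y - f y * sum_apply x)
  have hf : f ≠ 0 := by
    rintro rfl
    exact one_ne_zero (hli 1 0 (by ext x y; simp)).1
  have h0 : c 0 = 0 := by simpa [h1, h2, hf] using hc
  intro i
  fin_cases i <;> assumption

theorem exists_cross_eq_and_cross_eq (p q : Fin 3 → K) :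
    ∃ f g h : Fin 3 → K, f ⨯₃ g = p ∧ f ⨯₃ h = q := by
  obtain ⟨f, hf, hf0⟩ := Submodule.exists_mem_ne_zero_of_ne_bot
    (LinearMap.ker_ne_bot_of_finrank_lt (f := (Matrix.of ![p, q]).mulVecLin) (by simp))
  have hpf : p ⬝ᵥ f = 0 := congrFun hf 0
  have hqf : q ⬝ᵥ f = 0 := congrFun hf 1
  obtain ⟨i, hi⟩ := Function.ne_iff.1 hf0
  have hw : Pi.single i (f i)⁻¹ ⬝ᵥ f = 1 := by
    rw [single_dotProduct, inv_mul_cancel₀ hi]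
  have key (r : Fin 3 → K) (hr : r ⬝ᵥ f = 0) : f ⨯₃ (r ⨯₃ Pi.single i (f i)⁻¹) = r := by
    rw [cross_cross_eq_smul_sub_smul', dotProduct_comm f, hw, hr, one_smul, zero_smul, sub_zero]
  exact ⟨f, _, _, key p hpf, key q hqf⟩

theorem wedge_apply_eq_cross_dotProduct_cross (c : (Fin 3 → K) →ₗ[K] Dual K V) (v w : Fin 3 → K)
    (x y : V) :
    wedge (c v) (c w) x y =
      v ⨯₃ w ⬝ᵥ (fun i => c (Pi.single i 1) x) ⨯₃ (fun i => c (Pi.single i 1) y) := by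
  have apply_eq (v : Fin 3 → K) (x : V) : c v x = v ⬝ᵥ fun i => c (Pi.single i 1) x := by
    conv_lhs => rw [← (Pi.basisFun K (Fin 3)).sum_repr v]
    simp [dotProduct]
  rw [wedge_apply, cross_dot_cross, apply_eq v, apply_eq w, apply_eq v, apply_eq w]
  ring

theorem exists_apply_eq_dotProduct_cross {c : (Fin 3 → K) →ₗ[K] Dual K V}
    {ω : LinearMap.BilinForm K V}
    (hω : ω ∈ Submodule.span K (Set.image2 wedge (LinearMap.range c) (LinearMap.range c))) :
    ∃ p : Fin 3 → K, ∀ x y,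
      ω x y = p ⬝ᵥ (fun i => c (Pi.single i 1) x) ⨯₃ (fun i => c (Pi.single i 1) y) := by
  induction hω using Submodule.span_induction with
  | mem ω h =>
    obtain ⟨_, ⟨v, rfl⟩, _, ⟨w, rfl⟩, rfl⟩ := h
    exact ⟨v ⨯₃ w, wedge_apply_eq_cross_dotProduct_cross c v w⟩
  | zero => exact ⟨0, fun x y => by simp⟩
  | add ω₁ ω₂ _ _ h₁ h₂ =>
    obtain ⟨p, hp⟩ := h₁
    obtain ⟨q, hq⟩ := h₂
    exact ⟨p + q, fun x y => by rw [add_dotProduct, ← hp, ← hq]; rfl⟩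
  | smul a ω _ h =>
    obtain ⟨p, hp⟩ := h
    exact ⟨a • p, fun x y => by rw [smul_dotProduct, ← hp]; rfl⟩

theorem exists_range_eq_of_finrank_le (E : Submodule K V) [FiniteDimensional K E] {n : ℕ}
    (hE : finrank K E ≤ n) : ∃ c : (Fin n → K) →ₗ[K] V, LinearMap.range c = E := by
  obtain ⟨i, hi⟩ := finrank_le_iff_exists_linearMap.1 (hE.trans_eq (finrank_fin_fun K).symm)
  obtain ⟨s, hs⟩ := i.exists_leftInverse_of_injective (LinearMap.ker_eq_bot.2 hi)
  have hsurj : Function.Surjective s :=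
    Function.RightInverse.surjective (LinearMap.congr_fun hs)
  exact ⟨E.subtype ∘ₗ s, by
    rw [LinearMap.range_comp, LinearMap.range_eq_top.2 hsurj, Submodule.map_subtype_top]⟩

/-- In dimension at most 3 the exterior square is the cross product, so that a common factor of two
elements is a vector orthogonal to both. -/
theorem exists_common_factor {E : Subspace K (Dual K V)} [FiniteDimensional K E]
    (hE : finrank K E ≤ 3) {ω₁ ω₂ : LinearMap.BilinForm K V}
    (h₁ : ω₁ ∈ Submodule.span K (Set.image2 wedge E E))
    (h₂ : ω₂ ∈ Submodule.span K (Set.image2 wedge E E)) :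
    ∃ f ∈ E, ∃ g ∈ E, ∃ h ∈ E, ω₁ = wedge f g ∧ ω₂ = wedge f h := by
  obtain ⟨c, rfl⟩ := exists_range_eq_of_finrank_le E hE
  obtain ⟨p, hp⟩ := exists_apply_eq_dotProduct_cross h₁
  obtain ⟨q, hq⟩ := exists_apply_eq_dotProduct_cross h₂
  obtain ⟨f, g, h, rfl, rfl⟩ := exists_cross_eq_and_cross_eq p q
  refine ⟨c f, ⟨f, rfl⟩, c g, ⟨g, rfl⟩, c h, ⟨h, rfl⟩, ?_, ?_⟩
  · ext x y
    rw [hp, wedge_apply_eq_cross_dotProduct_cross]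
  · ext x y
    rw [hq, wedge_apply_eq_cross_dotProduct_cross]

variable {L : Type*} [LieRing L] [LieAlgebra K L] [FiniteDimensional K L] {A : Fin 2 → Dual K L}

theorem iso_n5_5_of_differential_eq_wedge (hA : IsDerivedCoordinates A) {f g h : Dual K L}
    (hf : differential f = 0) (hg : differential g = 0) (hh : differential h = 0)
    (h0 : differential (A 0) = wedge f g) (h1 : differential (A 1) = wedge f h) :
    Iso K L (MCAlg K n5_5 × MCAlg K (abelian (finrank K L - 5))) := by
  have hli : LinearIndependent K ![f, g, h] := by
    refine linearIndependent_of_wedge_ne_zero fun s t hst => ?_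
    have hc := hA.eq_zero_of_differential_eq_zero (c := ![s, t]) (by
      simp only [Fin.sum_univ_two, cons_val_zero, cons_val_one, map_add, map_smul, h0, h1]
      rw [← hst]
      ext x y
      simp only [LinearMap.add_apply, LinearMap.smul_apply, wedge_apply, smul_eq_mul]
      ring)
    exact ⟨congrFun hc 0, congrFun hc 1⟩
  refine iso_of_maurerCartan n5_5 (φ := ![f, g, A 0, h, A 1]) (fun k => ?_) (fun c => ?_)
    fun z hz hφ => hA.eq_zero z hz fun i => ?_
  · fin_cases k <;> simp [n5_5, hf, hg, hh, h0, h1]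
  · obtain ⟨x, hx, hx'⟩ := hA.exists_apply_eq hli (fun k => by fin_cases k <;> assumption)
      ![c 0, c 1, c 3] ![c 2, c 4]
    exact ⟨x, fun k => by
      fin_cases k
      exacts [hx 0, hx 1, hx' 0, hx 2, hx' 1]⟩
  · fin_cases i
    exacts [hφ 2, hφ 4]

/-- A common factor of the two differentials is the form `α₁` of `n5_5`. -/
theorem iso_n5_5_of_finrank_le_three (hA : IsDerivedCoordinates A) {E : Subspace K (Dual K L)}
    (hE : finrank K E ≤ 3) (hclosed : ∀ f ∈ E, differential f = 0)
    (h : ∀ i, differential (A i) ∈ Submodule.span K (Set.image2 wedge E E)) :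
    Iso K L (MCAlg K n5_5 × MCAlg K (abelian (finrank K L - 5))) := by
  obtain ⟨f, hf, g, hg, h, hh, h0, h1⟩ := exists_common_factor hE (h 0) (h 1)
  exact iso_n5_5_of_differential_eq_wedge hA (hclosed f hf) (hclosed g hg) (hclosed h hh) h0 h1

end CommonFactor

section Pencil

variable {K : Type*} [Field K]

theorem finrank_span_le_of_not_linearIndependent {V : Type*} [AddCommGroup V] [Module K V] {n : ℕ}
    {f : Fin (n + 1) → V} (hf : ¬LinearIndependent K f) {s : Set V}
    (hs : s ⊆ Submodule.span K (Set.range f)) : finrank K (Submodule.span K s) ≤ n := by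
  rw [linearIndependent_iff_card_le_finrank_span, Fintype.card_fin, not_le,
    Nat.lt_succ_iff] at hf
  have := FiniteDimensional.span_of_finite K (Set.finite_range f)
  exact (Submodule.finrank_mono (Submodule.span_le.2 hs)).trans hf

/-- Cartan's lemma: the cyclic identity says `ω₁ ∧ α + ω₂ ∧ β = 0`. -/
theorem exists_eq_wedge_add_wedge {V : Type*} [AddCommGroup V] [Module K V] {α β : Dual K V}
    (hαβ : LinearIndependent K ![α, β]) {ω₁ ω₂ : LinearMap.BilinForm K V}
    (h : ∀ x y z, (ω₁ x y * α z + ω₂ x y * β z) - (ω₁ x z * α y + ω₂ x z * β y) +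
      (ω₁ y z * α x + ω₂ y z * β x) = 0) :
    ∃ u v : V, ω₁ = wedge α (ω₁ u) + wedge β (ω₂ u) ∧
      ω₂ = wedge α (ω₂ u) + wedge β (ω₂ v + ω₂ u v • α) := by
  obtain ⟨u, hu⟩ := exists_apply_eq_of_linearIndependent hαβ ![1, 0]
  obtain ⟨v, hv⟩ := exists_apply_eq_of_linearIndependent hαβ ![0, 1]
  have hαu : α u = 1 := hu 0
  have hβu : β u = 0 := hu 1
  have hαv : α v = 0 := hv 0
  have hβv : β v = 1 := hv 1
  have contract_u (x y : V) :
      ω₁ x y = α x * ω₁ u y - α y * ω₁ u x + (β x * ω₂ u y - β y * ω₂ u x) := by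
    have := h u x y
    rw [hαu, hβu] at this
    linear_combination this
  have contract_v (x y : V) :
      ω₂ x y = α x * ω₁ v y - α y * ω₁ v x + (β x * ω₂ v y - β y * ω₂ v x) := by
    have := h v x y
    rw [hαv, hβv] at this
    linear_combination this
  refine ⟨u, v, ?_, ?_⟩
  · ext x y
    simp only [LinearMap.add_apply, wedge_apply]
    linear_combination contract_u x y
  · ext x y
    simp only [LinearMap.add_apply, wedge_apply, LinearMap.smul_apply, smul_eq_mul]
    have h₁v (z : V) := contract_u v z
    simp only [hαv, hβv] at h₁v
    linear_combination contract_v x y + α x * h₁v y - α y * h₁v x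

variable {L : Type*} [LieRing L] [LieAlgebra K L]

/-- The normal form given by Cartan's lemma for the differentials of coordinates `A` on a
two-dimensional derived algebra: a symmetric matrix of closed forms `(μ, ν; ν, ρ)` such that
`dA₀ = α ∧ μ + β ∧ ν` and `dA₁ = α ∧ ν + β ∧ ρ`. -/
structure IsPencil (A : Fin 2 → Dual K L) (α β μ ν ρ : Dual K L) : Prop where
  isDerivedCoordinates : IsDerivedCoordinates A
  linearIndependent : LinearIndependent K ![α, β]
  differential_zero : differential (A 0) = wedge α μ + wedge β ν
  differential_one : differential (A 1) = wedge α ν + wedge β ρ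
  differential_α : differential α = 0
  differential_β : differential β = 0
  differential_μ : differential μ = 0
  differential_ν : differential ν = 0
  differential_ρ : differential ρ = 0

theorem IsSymplecticForm.differential_eq_zero
    {θ : LinearMap.BilinForm K L} (hθ : IsSymplecticForm K L θ)
    (h2 : LieModule.lowerCentralSeries K L L 2 = ⊥) {z : L} (hz : z ∈ derivedAlgebra K L) :
    differential (θ z) = 0 := by
  ext x y
  have := hθ.closed x y z
  rw [lie_eq_zero_of_mem_derivedAlgebra h2 x hz, lie_eq_zero_of_mem_derivedAlgebra h2 y hz,
    map_zero, LinearMap.zero_apply, LinearMap.zero_apply, sub_zero, add_zero] at this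
  rw [differential_apply, ← hθ.alt.neg_eq, this, neg_zero]
  rfl

theorem exists_linearIndependent_span_eq_derivedAlgebra {n : ℕ} [NeZero n]
    (hfin : finrank K (derivedAlgebra K L) = n) : ∃ b : Fin n → L, LinearIndependent K b ∧
      Submodule.span K (Set.range b) = (derivedAlgebra K L).toSubmodule := by
  have := Module.finite_of_finrank_pos (hfin ▸ NeZero.pos n)
  let e := finBasisOfFinrankEq K (derivedAlgebra K L).toSubmodule hfin
  refine ⟨_, e.linearIndependent.map' _ (Submodule.ker_subtype _), ?_⟩
  rw [Set.range_comp, Submodule.span_image, e.span_eq, Submodule.map_subtype_top]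

theorem IsSymplectic.exists_isPencil (hs : IsSymplectic K L)
    (h2 : LieModule.lowerCentralSeries K L L 2 = ⊥)
    (hfin : finrank K (derivedAlgebra K L) = 2) :
    ∃ (A : Fin 2 → Dual K L) (α β μ ν ρ : Dual K L), IsPencil A α β μ ν ρ := by
  obtain ⟨θ, hθ⟩ := hs
  obtain ⟨b, hb, hspan⟩ := exists_linearIndependent_span_eq_derivedAlgebra hfin
  obtain ⟨A, hA, hAb⟩ := exists_isDerivedCoordinates hb hspan
  have hb_mem (i : Fin 2) : b i ∈ derivedAlgebra K L :=
    hspan.le (Submodule.subset_span ⟨i, rfl⟩)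
  have lie_eq (x y : L) : ⁅x, y⁆ = A 0 ⁅x, y⁆ • b 0 + A 1 ⁅x, y⁆ • b 1 := by
    rw [← Fin.sum_univ_two fun i => A i ⁅x, y⁆ • b i]
    exact hA.eq_sum hb_mem hAb (lie_mem_derivedAlgebra K x y)
  have hαβ : LinearIndependent K ![θ (b 0), θ (b 1)] := by
    have hcomp : θ ∘ b = ![θ (b 0), θ (b 1)] := funext (Fin.forall_fin_two.2 ⟨rfl, rfl⟩)
    exact hcomp ▸ hb.map' θ hθ.nondegenerate.ker_eq_bot
  have hα := hθ.differential_eq_zero h2 (hb_mem 0)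
  have hβ := hθ.differential_eq_zero h2 (hb_mem 1)
  have hclosed (φ : Dual K L) (u : L) : differential (differential φ u) = 0 := by
    ext x y
    simp [lie_eq_zero_of_mem_derivedAlgebra h2 u (lie_mem_derivedAlgebra K x y)]
  obtain ⟨u, v, h0, h1⟩ := exists_eq_wedge_add_wedge (ω₁ := differential (A 0))
    (ω₂ := differential (A 1)) hαβ fun x y z => by
      have := hθ.closed x y z
      rw [lie_eq x y, lie_eq x z, lie_eq y z] at this
      simpa using this
  exact ⟨A, _, _, _, _, _, hA, hαβ, h0, h1, hα, hβ, hclosed (A 0) u, hclosed (A 1) u,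
    by rw [map_add, map_smul, hclosed, hα, smul_zero, add_zero]⟩

end Pencil

section PencilIso

variable {K : Type*} [Field K] {L : Type*} [LieRing L] [LieAlgebra K L] [FiniteDimensional K L]
  {A : Fin 2 → Dual K L} {α β μ ν ρ : Dual K L}

namespace IsPencil

theorem iso_n5_5 (h : IsPencil A α β μ ν ρ) {f : Fin 4 → Dual K L}
    (hf : ¬LinearIndependent K f)
    (hspan : {α, β, μ, ν, ρ} ⊆ (Submodule.span K (Set.range f) : Set (Dual K L))) :
    Iso K L (MCAlg K n5_5 × MCAlg K (abelian (finrank K L - 5))) := by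
  have wedge_mem {f g : Dual K L} (hf : f ∈ ({α, β, μ, ν, ρ} : Set (Dual K L)))
      (hg : g ∈ ({α, β, μ, ν, ρ} : Set (Dual K L))) :
      wedge f g ∈ Submodule.span K
        (Set.image2 wedge (Submodule.span K {α, β, μ, ν, ρ}) (Submodule.span K {α, β, μ, ν, ρ})) :=
    Submodule.subset_span
      (Set.mem_image2_of_mem (Submodule.subset_span hf) (Submodule.subset_span hg))
  have hclosed : Submodule.span K {α, β, μ, ν, ρ} ≤ LinearMap.ker differential := by
    rw [Submodule.span_le]
    simp [Set.insert_subset_iff, h.differential_α, h.differential_β, h.differential_μ,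
      h.differential_ν, h.differential_ρ]
  refine iso_n5_5_of_finrank_le_three h.isDerivedCoordinates
    (finrank_span_le_of_not_linearIndependent hf hspan) hclosed fun i => ?_
  fin_cases i
  · exact h.differential_zero ▸ add_mem (wedge_mem (by simp) (by simp))
      (wedge_mem (by simp) (by simp))
  · exact h.differential_one ▸ add_mem (wedge_mem (by simp) (by simp))
      (wedge_mem (by simp) (by simp))

theorem iso_n7_124 (h : IsPencil A α β μ ν ρ) (hli : LinearIndependent K ![α, β, μ, ν, ρ]) :
    Iso K L (MCAlg K n7_124 × MCAlg K (abelian (finrank K L - 7))) := by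
  refine iso_of_maurerCartan n7_124 (φ := ![α, μ, A 0, ν, A 1, ρ, -β]) (fun k => ?_)
    (fun c => ?_) fun z hz hφ => h.isDerivedCoordinates.eq_zero z hz fun i => ?_
  · fin_cases k
    all_goals simp [n7_124, wedge_neg, h.differential_zero, h.differential_one, h.differential_α,
      h.differential_β, h.differential_μ, h.differential_ν, h.differential_ρ]
  · obtain ⟨x, hx, hx'⟩ := h.isDerivedCoordinates.exists_apply_eq hli (fun k => by
      fin_cases k
      exacts [h.differential_α, h.differential_β, h.differential_μ, h.differential_ν,
        h.differential_ρ]) ![c 0, -c 6, c 1, c 3, c 5] ![c 2, c 4]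
    refine ⟨x, fun k => ?_⟩
    fin_cases k
    exacts [hx 0, hx 2, hx' 0, hx 3, hx' 1, hx 4, neg_eq_iff_eq_neg.2 (hx 1)]
  · fin_cases i
    exacts [hφ 2, hφ 4]

theorem iso_n6_19 (h : IsPencil A α β 0 ν ρ) (hli : LinearIndependent K ![α, β, ν, ρ]) :
    Iso K L (MCAlg K n6_19 × MCAlg K (abelian (finrank K L - 6))) := by
  refine iso_of_maurerCartan n6_19 (φ := ![β, ν, A 0, ρ, A 1, -α]) (fun k => ?_)
    (fun c => ?_) fun z hz hφ => h.isDerivedCoordinates.eq_zero z hz fun i => ?_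
  · fin_cases k
    all_goals simp [n6_19, wedge_neg, h.differential_zero, h.differential_one, h.differential_α,
      h.differential_β, h.differential_ν, h.differential_ρ, add_comm]
  · obtain ⟨x, hx, hx'⟩ := h.isDerivedCoordinates.exists_apply_eq hli (fun k => by
      fin_cases k
      exacts [h.differential_α, h.differential_β, h.differential_ν, h.differential_ρ])
      ![-c 5, c 0, c 1, c 3] ![c 2, c 4]
    refine ⟨x, fun k => ?_⟩
    fin_cases k
    exacts [hx 1, hx 2, hx' 0, hx 3, hx' 1, neg_eq_iff_eq_neg.2 (hx 0)]
  · fin_cases i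
    exacts [hφ 2, hφ 4]

theorem iso_n3_1_prod_n3_1 (h : IsPencil A α β μ 0 ρ) (hli : LinearIndependent K ![α, μ, β, ρ]) :
    Iso K L ((MCAlg K n3_1 × MCAlg K n3_1) × MCAlg K (abelian (finrank K L - 6))) := by
  have h0 : differential (A 0) = wedge α μ := by
    rw [h.differential_zero, wedge_zero, add_zero]
  have h1 : differential (A 1) = wedge β ρ := by
    rw [h.differential_one, wedge_zero, zero_add]
  let φ := MCAlg.lift n3_1 ![α, μ, A 0] fun k => by
    fin_cases k <;> simp [n3_1, h.differential_α, h.differential_μ, h0]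
  let ψ := MCAlg.lift n3_1 ![β, ρ, A 1] fun k => by
    fin_cases k <;> simp [n3_1, h.differential_β, h.differential_ρ, h1]
  have hiso := iso_prod_abelian_of_surjective (φ.prod ψ) ?_ ?_
  · rwa [finrank_prod, MCAlg.finrank_eq] at hiso
  · rintro ⟨c, d⟩
    obtain ⟨x, hx, hx'⟩ := h.isDerivedCoordinates.exists_apply_eq hli (fun k => by
      fin_cases k
      exacts [h.differential_α, h.differential_μ, h.differential_β, h.differential_ρ])
      ![c 0, c 1, d 0, d 1] ![c 2, d 2]
    refine ⟨x, Prod.ext (funext fun k => ?_) (funext fun k => ?_)⟩ <;> fin_cases k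
    exacts [hx 0, hx 1, hx' 0, hx 2, hx 3, hx' 1]
  · intro z hz h0
    refine h.isDerivedCoordinates.eq_zero z hz fun i => ?_
    fin_cases i
    exacts [congrFun (congrArg Prod.fst h0) 2, congrFun (congrArg Prod.snd h0) 2]

theorem iso_n6_20_1 (h : IsPencil A α β μ ν (-μ)) (hli : LinearIndependent K ![α, β, μ, ν]) :
    Iso K L (MCAlg K n6_20_1 × MCAlg K (abelian (finrank K L - 6))) := by
  refine iso_of_maurerCartan n6_20_1 (φ := ![α, μ, A 0, ν, A 1, -β]) (fun k => ?_)
    (fun c => ?_) fun z hz hφ => h.isDerivedCoordinates.eq_zero z hz fun i => ?_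
  · fin_cases k
    all_goals simp [n6_20_1, wedge_neg, neg_one_smul_wedge, h.differential_zero, h.differential_one,
      h.differential_α, h.differential_β, h.differential_μ, h.differential_ν]
  · obtain ⟨x, hx, hx'⟩ := h.isDerivedCoordinates.exists_apply_eq hli (fun k => by
      fin_cases k
      exacts [h.differential_α, h.differential_β, h.differential_μ, h.differential_ν])
      ![c 0, -c 5, c 1, c 3] ![c 2, c 4]
    refine ⟨x, fun k => ?_⟩
    fin_cases k
    exacts [hx 0, hx 2, hx' 0, hx 3, hx' 1, neg_eq_iff_eq_neg.2 (hx 1)]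
  · fin_cases i
    exacts [hφ 2, hφ 4]

end IsPencil

end PencilIso

section PencilClassification

variable {K : Type*} [Field K] {L : Type*} [LieRing L] [LieAlgebra K L]

theorem IsDerivedCoordinates.smul_add_smul {A : Fin 2 → Dual K L} (hA : IsDerivedCoordinates A)
    {v₁ v₂ w₁ w₂ : K} (hδ : v₁ * w₂ - v₂ * w₁ ≠ 0) :
    IsDerivedCoordinates ![v₁ • A 0 + v₂ • A 1, w₁ • A 0 + w₂ • A 1] where
  eq_zero z hz h := by
    have hv : v₁ * A 0 z + v₂ * A 1 z = 0 := h 0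
    have hw : w₁ * A 0 z + w₂ * A 1 z = 0 := h 1
    refine hA.eq_zero z hz fun i => (mul_eq_zero_iff_left hδ).1 ?_
    match i with
    | 0 => linear_combination w₂ * hv - v₂ * hw
    | 1 => linear_combination v₁ * hw - w₁ * hv
  exists_eq t := by
    obtain ⟨z, hz, hAz⟩ := hA.exists_eq ((v₁ * w₂ - v₂ * w₁)⁻¹ •
      ![w₂ * t 0 - v₂ * t 1, v₁ * t 1 - w₁ * t 0])
    have h0 : A 0 z = (v₁ * w₂ - v₂ * w₁)⁻¹ * (w₂ * t 0 - v₂ * t 1) := hAz 0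
    have h1 : A 1 z = (v₁ * w₂ - v₂ * w₁)⁻¹ * (v₁ * t 1 - w₁ * t 0) := hAz 1
    refine ⟨z, hz, fun i => ?_⟩
    fin_cases i
    · change v₁ * A 0 z + v₂ * A 1 z = t 0
      rw [h0, h1]
      linear_combination t 0 * inv_mul_cancel₀ hδ
    · change w₁ * A 0 z + w₂ * A 1 z = t 1
      rw [h0, h1]
      linear_combination t 1 * inv_mul_cancel₀ hδ

namespace IsPencil

variable {A : Fin 2 → Dual K L} {α β μ ν ρ : Dual K L}

/-- The symmetric matrix `(μ, ν; ν, ρ)` is determined only up to the third-order symmetric tensors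
in `α`, `β`. -/
theorem add_smul_add_smul (h : IsPencil A α β μ ν ρ) (a b c d : K) :
    IsPencil A α β (μ + (a • α + b • β)) (ν + (b • α + c • β)) (ρ + (c • α + d • β)) where
  isDerivedCoordinates := h.isDerivedCoordinates
  linearIndependent := h.linearIndependent
  differential_zero := by
    rw [h.differential_zero]
    ext x y
    simp
    ring
  differential_one := by
    rw [h.differential_one]
    ext x y
    simp
    ring
  differential_α := h.differential_α
  differential_β := h.differential_β
  differential_μ := by simp [h.differential_α, h.differential_β, h.differential_μ]
  differential_ν := by simp [h.differential_α, h.differential_β, h.differential_ν]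
  differential_ρ := by simp [h.differential_α, h.differential_β, h.differential_ρ]

theorem transform (h : IsPencil A α β μ ν ρ) {v₁ v₂ w₁ w₂ δ : K} (hδ : δ = v₁ * w₂ - v₂ * w₁)
    (hδ0 : δ ≠ 0) :
    IsPencil ![(δ * v₁) • A 0 + (δ * v₂) • A 1, (δ * w₁) • A 0 + (δ * w₂) • A 1]
      (w₂ • α + -w₁ • β) (-v₂ • α + v₁ • β)
      (v₁ ^ 2 • μ + (2 * v₁ * v₂) • ν + v₂ ^ 2 • ρ)
      ((v₁ * w₁) • μ + (v₁ * w₂ + v₂ * w₁) • ν + (v₂ * w₂) • ρ)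
      (w₁ ^ 2 • μ + (2 * w₁ * w₂) • ν + w₂ ^ 2 • ρ) where
  isDerivedCoordinates := h.isDerivedCoordinates.smul_add_smul (by
    rw [show δ * v₁ * (δ * w₂) - δ * v₂ * (δ * w₁) = δ ^ 3 by rw [hδ]; ring]
    exact pow_ne_zero 3 hδ0)
  linearIndependent := (LinearIndependent.pair_add_smul_add_smul_iff ..).2
    ⟨h.linearIndependent, fun h0 => hδ0 (by linear_combination h0 + hδ)⟩
  differential_zero := by
    change differential ((δ * v₁) • A 0 + (δ * v₂) • A 1) = _
    rw [map_add, map_smul, map_smul, h.differential_zero, h.differential_one, hδ]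
    ext x y
    simp
    ring
  differential_one := by
    change differential ((δ * w₁) • A 0 + (δ * w₂) • A 1) = _
    rw [map_add, map_smul, map_smul, h.differential_zero, h.differential_one, hδ]
    ext x y
    simp
    ring
  differential_α := by simp [h.differential_α, h.differential_β]
  differential_β := by simp [h.differential_α, h.differential_β]
  differential_μ := by simp [h.differential_μ, h.differential_ν, h.differential_ρ]
  differential_ν := by simp [h.differential_μ, h.differential_ν, h.differential_ρ]
  differential_ρ := by simp [h.differential_μ, h.differential_ν, h.differential_ρ]

end IsPencil

section HasPencilRelation

variable (K L)

/-- Some pencil on `L` satisfies the linear relation `c • μ + d • ν + e • ρ = 0`. Under changes of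
coordinates on the derived algebra, `(c, d, e)` behaves as the binary quadratic form
`c X² + d X Y + e Y²` up to scalars. -/
def HasPencilRelation (c d e : K) : Prop :=
  ∃ (A : Fin 2 → Dual K L) (α β μ ν ρ : Dual K L),
    IsPencil A α β μ ν ρ ∧ c • μ + d • ν + e • ρ = 0

variable {K L}

theorem IsPencil.hasPencilRelation {A : Fin 2 → Dual K L} {α β μ ν ρ : Dual K L}
    (h : IsPencil A α β μ ν ρ) {k l c d e : K} (hcde : ¬(c = 0 ∧ d = 0 ∧ e = 0))
    (hrel : k • α + l • β + c • μ + d • ν + e • ρ = 0) : HasPencilRelation K L c d e := by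
  obtain ⟨a₀, a₁, a₂, a₃, hk, hl⟩ : ∃ a₀ a₁ a₂ a₃ : K,
      c * a₀ + d * a₁ + e * a₂ = k ∧ c * a₁ + d * a₂ + e * a₃ = l := by
    by_cases hc : c = 0
    · by_cases he : e = 0
      · have hd : d ≠ 0 := fun hd => hcde ⟨hc, hd, he⟩
        exact ⟨0, k / d, l / d, 0, by field_simp; simp [hc, he], by field_simp; simp [hc, he]⟩
      · exact ⟨0, 0, k / e, (l - d * (k / e)) / e, by field_simp; ring, by field_simp; ring⟩
    · exact ⟨(k - d * (l / c)) / c, l / c, 0, 0, by field_simp; ring, by field_simp; ring⟩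
  refine ⟨A, α, β, _, _, _, h.add_smul_add_smul a₀ a₁ a₂ a₃, ?_⟩
  rw [← hrel, ← hk, ← hl]
  module

theorem HasPencilRelation.transform {c d e : K} (h : HasPencilRelation K L c d e)
    {v₁ v₂ w₁ w₂ c' d' e' t : K} (hδ : v₁ * w₂ - v₂ * w₁ ≠ 0)
    (hc : c' * v₁ ^ 2 + d' * (v₁ * w₁) + e' * w₁ ^ 2 = t * c)
    (hd : c' * (2 * v₁ * v₂) + d' * (v₁ * w₂ + v₂ * w₁) + e' * (2 * w₁ * w₂) = t * d)
    (he : c' * v₂ ^ 2 + d' * (v₂ * w₂) + e' * w₂ ^ 2 = t * e) :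
    HasPencilRelation K L c' d' e' := by
  obtain ⟨A, α, β, μ, ν, ρ, h, hrel⟩ := h
  refine ⟨_, _, _, _, _, _, h.transform rfl hδ, ?_⟩
  ext x
  have hrel_x : c * μ x + d * ν x + e * ρ x = 0 := LinearMap.congr_fun hrel x
  simp only [LinearMap.add_apply, LinearMap.smul_apply, smul_eq_mul, LinearMap.zero_apply]
  linear_combination t * hrel_x + hc * μ x + hd * ν x + he * ρ x

/-- Completing the square reduces the quadratic form `(c, d, e)` to `X²`, `X Y` or `X² + Y²`. -/
theorem HasPencilRelation.normal_form [NeZero (2 : K)] (hK : ∀ d : K, IsSquare d ∨ IsSquare (-d))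
    {c d e : K} (hcde : ¬(c = 0 ∧ d = 0 ∧ e = 0)) (h : HasPencilRelation K L c d e) :
    HasPencilRelation K L 1 0 0 ∨ HasPencilRelation K L 0 1 0 ∨
      (¬IsSquare (-1 : K) ∧ HasPencilRelation K L 1 0 1) := by
  by_cases hc : c = 0
  · by_cases hd : d = 0
    · have he : e ≠ 0 := fun he => hcde ⟨hc, hd, he⟩
      exact Or.inl (h.transform (v₁ := 0) (v₂ := 1) (w₁ := 1) (w₂ := 0) (t := e⁻¹) (by simp)
        (by simp [hc]) (by simp [hd]) (by simp [he]))
    · exact Or.inr (Or.inl (h.transform (v₁ := 0) (v₂ := 1) (w₁ := d) (w₂ := e) (t := 1)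
        (by simpa using hd) (by simp [hc]) (by ring) (by ring)))
  have h2c : 2 * c ≠ 0 := mul_ne_zero two_ne_zero hc
  by_cases hsq : IsSquare (d ^ 2 - 4 * c * e)
  · obtain ⟨s, hs⟩ := hsq
    by_cases hs0 : s = 0
    · rw [hs0, mul_zero] at hs
      exact Or.inl (h.transform (v₁ := 2 * c) (v₂ := d) (w₁ := 0) (w₂ := 1) (t := 4 * c)
        (by simpa using h2c) (by ring) (by ring) (by linear_combination hs))
    · exact Or.inr (Or.inl (h.transform (v₁ := 2 * c) (v₂ := d - s) (w₁ := 2 * c) (w₂ := d + s)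
        (t := 4 * c) (by
          rw [show 2 * c * (d + s) - (d - s) * (2 * c) = 2 * c * (2 * s) by ring]
          exact mul_ne_zero h2c (mul_ne_zero two_ne_zero hs0))
        (by ring) (by ring) (by linear_combination hs)))
  · obtain ⟨r, hr⟩ := (hK _).resolve_left hsq
    have hneg : ¬IsSquare (-1 : K) := fun h1 => hsq (by
      simpa using h1.mul (⟨r, hr⟩ : IsSquare (-(d ^ 2 - 4 * c * e))))
    have hr0 : r ≠ 0 := by
      rintro rfl
      exact hsq ⟨0, by linear_combination -hr⟩
    exact Or.inr (Or.inr ⟨hneg, h.transform (v₁ := 2 * c) (v₂ := d) (w₁ := 0) (w₂ := r)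
      (t := 4 * c) (by simpa using mul_ne_zero h2c hr0) (by ring) (by ring)
      (by linear_combination -hr)⟩)

variable [FiniteDimensional K L]

theorem HasPencilRelation.iso_n6_19_or_n5_5 (h : HasPencilRelation K L 1 0 0) :
    Iso K L (MCAlg K n6_19 × MCAlg K (abelian (finrank K L - 6))) ∨
      Iso K L (MCAlg K n5_5 × MCAlg K (abelian (finrank K L - 5))) := by
  obtain ⟨A, α, β, μ, ν, ρ, h, hrel⟩ := h
  obtain rfl : μ = 0 := by simpa using hrel
  by_cases hli : LinearIndependent K ![α, β, ν, ρ]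
  · exact Or.inl (h.iso_n6_19 hli)
  · exact Or.inr (h.iso_n5_5 hli (by simp [Set.insert_subset_iff, Submodule.mem_span_of_mem]))

theorem HasPencilRelation.iso_n3_1_prod_n3_1_or_n5_5 (h : HasPencilRelation K L 0 1 0) :
    Iso K L ((MCAlg K n3_1 × MCAlg K n3_1) × MCAlg K (abelian (finrank K L - 6))) ∨
      Iso K L (MCAlg K n5_5 × MCAlg K (abelian (finrank K L - 5))) := by
  obtain ⟨A, α, β, μ, ν, ρ, h, hrel⟩ := h
  obtain rfl : ν = 0 := by simpa using hrel
  by_cases hli : LinearIndependent K ![α, μ, β, ρ]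
  · exact Or.inl (h.iso_n3_1_prod_n3_1 hli)
  · exact Or.inr (h.iso_n5_5 hli (by simp [Set.insert_subset_iff, Submodule.mem_span_of_mem]))

theorem HasPencilRelation.iso_n6_20_1_or_n5_5 (h : HasPencilRelation K L 1 0 1) :
    Iso K L (MCAlg K n6_20_1 × MCAlg K (abelian (finrank K L - 6))) ∨
      Iso K L (MCAlg K n5_5 × MCAlg K (abelian (finrank K L - 5))) := by
  obtain ⟨A, α, β, μ, ν, ρ, h, hrel⟩ := h
  obtain rfl : ρ = -μ := by simpa [add_eq_zero_iff_neg_eq, eq_comm] using hrel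
  by_cases hli : LinearIndependent K ![α, β, μ, ν]
  · exact Or.inl (h.iso_n6_20_1 hli)
  · exact Or.inr (h.iso_n5_5 hli (by simp [Set.insert_subset_iff, Submodule.mem_span_of_mem]))

theorem IsPencil.iso [NeZero (2 : K)] (hK : ∀ d : K, IsSquare d ∨ IsSquare (-d))
    {A : Fin 2 → Dual K L} {α β μ ν ρ : Dual K L} (h : IsPencil A α β μ ν ρ) :
    Iso K L (MCAlg K n7_124 × MCAlg K (abelian (finrank K L - 7))) ∨
      Iso K L (MCAlg K n6_19 × MCAlg K (abelian (finrank K L - 6))) ∨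
      Iso K L (MCAlg K n5_5 × MCAlg K (abelian (finrank K L - 5))) ∨
      Iso K L ((MCAlg K n3_1 × MCAlg K n3_1) × MCAlg K (abelian (finrank K L - 6))) ∨
      (¬IsSquare (-1 : K) ∧
        Iso K L (MCAlg K n6_20_1 × MCAlg K (abelian (finrank K L - 6)))) := by
  by_cases hli : LinearIndependent K ![α, β, μ, ν, ρ]
  · exact Or.inl (h.iso_n7_124 hli)
  obtain ⟨c, hc, hc0⟩ := Fintype.not_linearIndependent_iff.1 hli
  simp only [Fin.sum_univ_five, Matrix.cons_val] at hc
  have hcde : ¬(c 2 = 0 ∧ c 3 = 0 ∧ c 4 = 0) := by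
    rintro ⟨h2, h3, h4⟩
    obtain ⟨h0, h1⟩ := LinearIndependent.pair_iff.1 h.linearIndependent (c 0) (c 1)
      (by simpa [h2, h3, h4] using hc)
    obtain ⟨i, hi⟩ := hc0
    fin_cases i <;> contradiction
  rcases (h.hasPencilRelation hcde hc).normal_form hK hcde with hrel | hrel | ⟨hneg, hrel⟩
  · have := hrel.iso_n6_19_or_n5_5
    tauto
  · have := hrel.iso_n3_1_prod_n3_1_or_n5_5
    tauto
  · have := hrel.iso_n6_20_1_or_n5_5
    tauto

end HasPencilRelation

end PencilClassification

section RankSemicontinuity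

variable {K : Type*} [Field K] {V W : Type*} [AddCommGroup V] [Module K V]
  [AddCommGroup W] [Module K W]

theorem finrank_span_pair {v w : V} (hvw : LinearIndependent K ![v, w]) :
    finrank K (Submodule.span K {v, w}) = 2 := by
  rw [← Matrix.range_cons_cons_empty v w ![], finrank_span_eq_card hvw, Fintype.card_fin]

theorem exists_linearIndependent_smul_sub [Infinite K] {ι : Type*} [Finite ι] {v : ι → V}
    (hv : LinearIndependent K v) (w : ι → V) :
    ∃ s : K, LinearIndependent K fun i => s • v i - w i := by
  classical
  have := Fintype.ofFinite ι
  choose φ hφ using fun j =>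
    exists_dual_apply_eq_of_linearIndependent hv fun i => if i = j then (1 : K) else 0
  let N : Matrix ι ι K := .of fun i j => φ j (w i)
  obtain ⟨s, hs⟩ := Infinite.exists_notMem_finset N.charpoly.roots.toFinset
  rw [Multiset.mem_toFinset, Polynomial.mem_roots N.charpoly_monic.ne_zero, Polynomial.IsRoot,
    Matrix.eval_charpoly] at hs
  have hcoord : (LinearMap.pi φ ∘ fun i => s • v i - w i) = Matrix.scalar ι s - N := by
    ext i j
    simp [N, hφ, Matrix.diagonal_apply]
  exact ⟨s, .of_comp (LinearMap.pi φ) (hcoord ▸ Matrix.linearIndependent_rows_of_det_ne_zero hs)⟩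

theorem apply_mem_range_of_finrank_range_le [Infinite K] [FiniteDimensional K W]
    {T S : V →ₗ[K] W}
    (h : ∀ s : K, finrank K (LinearMap.range (s • T - S)) ≤ finrank K (LinearMap.range T))
    {v : V} (hv : T v = 0) : S v ∈ LinearMap.range T := by
  by_contra hSv
  let b := finBasis K (LinearMap.range T)
  choose u hu using fun i => (b i).2
  have hli : LinearIndependent K (Fin.cons (S v) fun i => T (u i) : Fin (_ + 1) → W) := by
    refine linearIndependent_finCons.2 ⟨?_, fun hmem => hSv (Submodule.span_le.2 ?_ hmem)⟩
    · simp only [hu]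
      exact b.linearIndependent.map' _ (Submodule.ker_subtype _)
    · rintro _ ⟨i, rfl⟩
      exact ⟨u i, rfl⟩
  obtain ⟨s, hs⟩ :=
    exists_linearIndependent_smul_sub hli (Fin.cons 0 fun i => S (u i))
  have hle : Submodule.span K (Set.range fun i => s • (Fin.cons (S v) fun i => T (u i) :
      Fin (_ + 1) → W) i - (Fin.cons 0 fun i => S (u i) : Fin (_ + 1) → W) i) ≤
      LinearMap.range (s • T - S) := by
    rw [Submodule.span_le]
    rintro _ ⟨i, rfl⟩
    refine Fin.cases ⟨-s • v, ?_⟩ (fun i => ⟨u i, ?_⟩) i <;> simp [hv]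
  have := (Submodule.finrank_mono hle).trans (h s)
  rw [finrank_span_eq_card hs, Fintype.card_fin] at this
  omega

end RankSemicontinuity

section RankTwo

variable {K : Type*} [Field K] {L : Type*} [LieRing L] [LieAlgebra K L] [FiniteDimensional K L]
  {x y z : L}

theorem lie_mem_range_ad [Infinite K]
    (hx : ∀ u : L, finrank K (LieAlgebra.ad K L u).range ≤ finrank K (LieAlgebra.ad K L x).range)
    {w : L} (hw : ⁅x, w⁆ = 0) (u : L) : ⁅u, w⁆ ∈ (LieAlgebra.ad K L x).range :=
  apply_mem_range_of_finrank_range_le (S := LieAlgebra.ad K L u)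
    (fun s => by rw [← map_smul, ← map_sub]; exact hx (s • x - u)) hw

theorem range_ad_eq_span (hx : finrank K (LieAlgebra.ad K L x).range ≤ 2)
    (hli : LinearIndependent K ![⁅x, y⁆, ⁅x, z⁆]) :
    (LieAlgebra.ad K L x).range = Submodule.span K {⁅x, y⁆, ⁅x, z⁆} := by
  refine (Submodule.eq_of_le_of_finrank_le ?_ (hx.trans_eq (finrank_span_pair hli).symm)).symm
  rw [Submodule.span_le, Set.pair_subset_iff]
  exact ⟨⟨y, rfl⟩, ⟨z, rfl⟩⟩

variable (hrank : ∀ u : L, finrank K (LieAlgebra.ad K L u).range ≤ 2)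
include hrank

theorem lie_mem_range_ad_of_linearIndependent [Infinite K]
    (hli : LinearIndependent K ![⁅x, y⁆, ⁅x, z⁆]) {w : L} (hw : ⁅x, w⁆ = 0) (u : L) :
    ⁅u, w⁆ ∈ (LieAlgebra.ad K L x).range := by
  refine lie_mem_range_ad (fun v => (hrank v).trans_eq ?_) hw u
  rw [range_ad_eq_span (hrank x) hli, finrank_span_pair hli]

theorem derivedAlgebra_le_of_lie_mem [Infinite K] (hli : LinearIndependent K ![⁅x, y⁆, ⁅x, z⁆])
    {W : Submodule K L} (hxy : ⁅x, y⁆ ∈ W) (hxz : ⁅x, z⁆ ∈ W) (hyz : ⁅y, z⁆ ∈ W) :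
    (derivedAlgebra K L).toSubmodule ≤ W := by
  have hker {w : L} (hw : ⁅x, w⁆ = 0) (u : L) : ⁅u, w⁆ ∈ W :=
    Submodule.span_le.2 (Set.pair_subset_iff.2 ⟨hxy, hxz⟩)
      ((range_ad_eq_span (hrank x) hli).le
        (lie_mem_range_ad_of_linearIndependent hrank hli hw u))
  have hdecomp (u : L) : ∃ s t : K, ⁅x, u - (s • y + t • z)⁆ = 0 := by
    obtain ⟨s, t, hst⟩ := Submodule.mem_span_pair.1
      ((range_ad_eq_span (hrank x) hli).le ⟨u, rfl⟩)
    exact ⟨s, t, by rw [lie_sub, lie_add, lie_smul, lie_smul, hst, LieAlgebra.ad_apply, sub_self]⟩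
  refine derivedAlgebra_le fun u v => ?_
  obtain ⟨s, t, hu⟩ := hdecomp u
  obtain ⟨s', t', hv⟩ := hdecomp v
  have hsum : ⁅u, v⁆ = ⁅u, v - (s' • y + t' • z)⁆ - ⁅s' • y + t' • z, u - (s • y + t • z)⁆ +
      (s * t' - t * s') • ⁅y, z⁆ := by
    simp only [lie_sub, lie_add, add_lie, lie_smul, smul_lie, lie_self, ← lie_skew z y,
      ← lie_skew u y, ← lie_skew u z]
    module
  rw [hsum]
  exact W.add_mem (W.sub_mem (hker hv u) (hker hu _)) (W.smul_mem _ hyz)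

end RankTwo

section FreeTriple

variable {K : Type*} [Field K] {L : Type*} [LieRing L] [LieAlgebra K L]

/-- The brackets `⁅x, y⁆`, `⁅x, z⁆`, `⁅y, z⁆` form a basis of the derived algebra, with dual
coordinates `A`. Over a 2-step nilpotent algebra this says that `x`, `y`, `z` generate a copy of
`n6_20`, the free 2-step nilpotent Lie algebra on three generators, that contains `C¹(L)`. -/
structure IsFreeTriple (A : Fin 3 → Dual K L) (x y z : L) : Prop where
  isDerivedCoordinates : IsDerivedCoordinates A
  apply_lie : ∀ i j, A i (![⁅x, y⁆, ⁅x, z⁆, ⁅y, z⁆] j) = if i = j then 1 else 0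

theorem exists_isFreeTriple {x y z : L} (hli : LinearIndependent K ![⁅x, y⁆, ⁅x, z⁆, ⁅y, z⁆])
    (hle : (derivedAlgebra K L).toSubmodule ≤ Submodule.span K (Set.range
      ![⁅x, y⁆, ⁅x, z⁆, ⁅y, z⁆])) : ∃ A : Fin 3 → Dual K L, IsFreeTriple A x y z := by
  suffices hge : Submodule.span K (Set.range ![⁅x, y⁆, ⁅x, z⁆, ⁅y, z⁆]) ≤
      (derivedAlgebra K L).toSubmodule by
    obtain ⟨A, hA, hAe⟩ := exists_isDerivedCoordinates hli (hge.antisymm hle)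
    exact ⟨A, hA, hAe⟩
  rw [Submodule.span_le]
  rintro _ ⟨i, rfl⟩
  fin_cases i
  exacts [lie_mem_derivedAlgebra K x y, lie_mem_derivedAlgebra K x z, lie_mem_derivedAlgebra K y z]

theorem linearIndependent_pair_of_apply {V : Type*} [AddCommGroup V] [Module K V] {v w : V}
    {f g : Dual K V} (hfv : f v ≠ 0) (hfw : f w = 0) (hgw : g w ≠ 0) :
    LinearIndependent K ![v, w] := by
  refine LinearIndependent.pair_iff.2 fun s t h => ?_
  have hs : s = 0 := by simpa [hfv, hfw] using congrArg f h
  exact ⟨hs, by simpa [hgw, hs] using congrArg g h⟩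

theorem apply_lie_eq_zero [FiniteDimensional K L] {x y z : L}
    (hx : finrank K (LieAlgebra.ad K L x).range ≤ 2)
    (hli : LinearIndependent K ![⁅x, y⁆, ⁅x, z⁆]) {φ : Dual K L} (hφy : φ ⁅x, y⁆ = 0)
    (hφz : φ ⁅x, z⁆ = 0) (u : L) : φ ⁅x, u⁆ = 0 := by
  have hker : Submodule.span K {⁅x, y⁆, ⁅x, z⁆} ≤ LinearMap.ker φ :=
    Submodule.span_le.2 (Set.pair_subset_iff.2 ⟨hφy, hφz⟩)
  exact hker ((range_ad_eq_span hx hli).le ⟨u, rfl⟩)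

/-- The linear forms dual to the generators `x`, `y`, `z` of a free triple, read off from the
brackets with `x` and `y`; they vanish on the center. -/
def generatorForm (A : Fin 3 → Dual K L) (x y : L) : Fin 3 → Dual K L :=
  ![-(A 0 ∘ₗ LieAlgebra.ad K L y), A 0 ∘ₗ LieAlgebra.ad K L x, A 1 ∘ₗ LieAlgebra.ad K L x]

theorem differential_generatorForm (h2 : LieModule.lowerCentralSeries K L L 2 = ⊥)
    (A : Fin 3 → Dual K L) (x y : L) (i : Fin 3) : differential (generatorForm A x y i) = 0 := by
  ext u v
  have hlie (w : L) : ⁅w, ⁅u, v⁆⁆ = 0 :=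
    lie_eq_zero_of_mem_derivedAlgebra h2 w (lie_mem_derivedAlgebra K u v)
  fin_cases i <;> simp [generatorForm, hlie]

namespace IsFreeTriple

variable {A : Fin 3 → Dual K L} {x y z : L} (h : IsFreeTriple A x y z)
include h

theorem apply_xy (i : Fin 3) : A i ⁅x, y⁆ = if i = 0 then 1 else 0 := h.apply_lie i 0

theorem apply_xz (i : Fin 3) : A i ⁅x, z⁆ = if i = 1 then 1 else 0 := h.apply_lie i 1

theorem apply_yz (i : Fin 3) : A i ⁅y, z⁆ = if i = 2 then 1 else 0 := h.apply_lie i 2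

theorem apply_yx (i : Fin 3) : A i ⁅y, x⁆ = if i = 0 then -1 else 0 := by
  rw [← lie_skew, map_neg, h.apply_xy, neg_ite, neg_zero]

theorem apply_zx (i : Fin 3) : A i ⁅z, x⁆ = if i = 1 then -1 else 0 := by
  rw [← lie_skew, map_neg, h.apply_xz, neg_ite, neg_zero]

theorem apply_zy (i : Fin 3) : A i ⁅z, y⁆ = if i = 2 then -1 else 0 := by
  rw [← lie_skew, map_neg, h.apply_yz, neg_ite, neg_zero]

theorem linearIndependent_lie_x : LinearIndependent K ![⁅x, y⁆, ⁅x, z⁆] :=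
  linearIndependent_pair_of_apply (f := A 0) (g := A 1) (by simp [h.apply_xy])
    (by simp [h.apply_xz]) (by simp [h.apply_xz])

theorem linearIndependent_lie_y : LinearIndependent K ![⁅y, x⁆, ⁅y, z⁆] :=
  linearIndependent_pair_of_apply (f := A 0) (g := A 2) (by simp [h.apply_yx])
    (by simp [h.apply_yz]) (by simp [h.apply_yz])

theorem linearIndependent_lie_z : LinearIndependent K ![⁅z, x⁆, ⁅z, y⁆] :=
  linearIndependent_pair_of_apply (f := A 1) (g := A 2) (by simp [h.apply_zx])
    (by simp [h.apply_zy]) (by simp [h.apply_zy])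

theorem linearIndependent_generatorForm : LinearIndependent K (generatorForm A x y) := by
  refine Fintype.linearIndependent_iff.2 fun c hc i => ?_
  fin_cases i
  · simpa [Fin.sum_univ_three, generatorForm, h.apply_yx] using LinearMap.congr_fun hc x
  · simpa [Fin.sum_univ_three, generatorForm, h.apply_xy] using LinearMap.congr_fun hc y
  · simpa [Fin.sum_univ_three, generatorForm, h.apply_xz, h.apply_yz] using
      LinearMap.congr_fun hc z

section RankTwo

variable [FiniteDimensional K L] (hrank : ∀ u : L, finrank K (LieAlgebra.ad K L u).range ≤ 2)
include hrank

theorem apply_two_lie_x (u : L) : A 2 ⁅x, u⁆ = 0 :=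
  apply_lie_eq_zero (hrank x) h.linearIndependent_lie_x (by simp [h.apply_xy])
    (by simp [h.apply_xz]) u

theorem apply_one_lie_y (u : L) : A 1 ⁅y, u⁆ = 0 :=
  apply_lie_eq_zero (hrank y) h.linearIndependent_lie_y (by simp [h.apply_yx])
    (by simp [h.apply_yz]) u

theorem apply_zero_lie_z (u : L) : A 0 ⁅z, u⁆ = 0 :=
  apply_lie_eq_zero (hrank z) h.linearIndependent_lie_z (by simp [h.apply_zx])
    (by simp [h.apply_zy]) u

theorem apply_two_lie_y (u : L) : A 2 ⁅y, u⁆ = A 1 ⁅x, u⁆ := by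
  have hli : LinearIndependent K ![⁅x + y, x⁆, ⁅x + y, z⁆] :=
    linearIndependent_pair_of_apply (f := A 0) (g := A 1) (by simp [h.apply_yx])
      (by simp [h.apply_xz, h.apply_yz]) (by simp [h.apply_xz, h.apply_yz])
  have hu := apply_lie_eq_zero (φ := A 1 - A 2) (hrank (x + y)) hli (by simp [h.apply_yx])
    (by simp [h.apply_xz, h.apply_yz]) u
  refine (sub_eq_zero.1 ?_).symm
  simpa [h.apply_two_lie_x hrank, h.apply_one_lie_y hrank] using hu

theorem apply_two_lie_z (u : L) : A 2 ⁅z, u⁆ = -A 0 ⁅x, u⁆ := by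
  have hli : LinearIndependent K ![⁅x + z, x⁆, ⁅x + z, y⁆] :=
    linearIndependent_pair_of_apply (f := A 1) (g := A 0) (by simp [h.apply_zx])
      (by simp [h.apply_xy, h.apply_zy]) (by simp [h.apply_xy, h.apply_zy])
  have hu := apply_lie_eq_zero (φ := A 0 + A 2) (hrank (x + z)) hli (by simp [h.apply_zx])
    (by simp [h.apply_xy, h.apply_zy]) u
  rw [eq_neg_iff_add_eq_zero, add_comm]
  simpa [h.apply_two_lie_x hrank, h.apply_zero_lie_z hrank] using hu

theorem apply_one_lie_z (u : L) : A 1 ⁅z, u⁆ = A 0 ⁅y, u⁆ := by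
  have hli : LinearIndependent K ![⁅y + z, x⁆, ⁅y + z, z⁆] :=
    linearIndependent_pair_of_apply (f := A 0) (g := A 2) (by simp [h.apply_yx, h.apply_zx])
      (by simp [h.apply_yz]) (by simp [h.apply_yz])
  have hu := apply_lie_eq_zero (φ := A 0 - A 1) (hrank (y + z)) hli
    (by simp [h.apply_yx, h.apply_zx]) (by simp [h.apply_yz]) u
  refine (sub_eq_zero.1 ?_).symm
  simpa [h.apply_one_lie_y hrank, h.apply_zero_lie_z hrank] using hu

theorem lie_eq_zero_of_lie_eq_zero [Infinite K] {w : L} (hx : ⁅x, w⁆ = 0) (hy : ⁅y, w⁆ = 0)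
    (hz : ⁅z, w⁆ = 0) (v : L) : ⁅v, w⁆ = 0 := by
  refine h.isDerivedCoordinates.eq_zero _ (lie_mem_derivedAlgebra K v w) fun i => ?_
  fin_cases i
  · obtain ⟨u, hu⟩ := lie_mem_range_ad_of_linearIndependent hrank h.linearIndependent_lie_z hz v
    exact hu ▸ h.apply_zero_lie_z hrank u
  · obtain ⟨u, hu⟩ := lie_mem_range_ad_of_linearIndependent hrank h.linearIndependent_lie_y hy v
    exact hu ▸ h.apply_one_lie_y hrank u
  · obtain ⟨u, hu⟩ := lie_mem_range_ad_of_linearIndependent hrank h.linearIndependent_lie_x hx v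
    exact hu ▸ h.apply_two_lie_x hrank u

theorem lie_eq [Infinite K] (u v : L) : ⁅u, v⁆ = generatorForm A x y 0 u • ⁅x, v⁆ +
    generatorForm A x y 1 u • ⁅y, v⁆ + generatorForm A x y 2 u • ⁅z, v⁆ := by
  let w := u - (-A 0 ⁅y, u⁆ • x + A 0 ⁅x, u⁆ • y + A 1 ⁅x, u⁆ • z)
  have hw : ⁅v, w⁆ = 0 := by
    refine h.lie_eq_zero_of_lie_eq_zero hrank ?_ ?_ ?_ v
    all_goals
      refine h.isDerivedCoordinates.eq_zero _ (lie_mem_derivedAlgebra K _ w) fun i => ?_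
      fin_cases i <;> simp [w, h.apply_xy, h.apply_xz, h.apply_yz, h.apply_yx, h.apply_zx,
        h.apply_zy, h.apply_two_lie_x hrank, h.apply_one_lie_y hrank, h.apply_zero_lie_z hrank,
        h.apply_two_lie_y hrank, h.apply_two_lie_z hrank, h.apply_one_lie_z hrank]
  rw [← lie_skew, neg_eq_zero] at hw
  simpa [w, sub_eq_zero, generatorForm] using hw

theorem differential_zero [Infinite K] :
    differential (A 0) = wedge (generatorForm A x y 0) (generatorForm A x y 1) := by
  ext u v
  rw [differential_apply, h.lie_eq hrank u v]
  simp [generatorForm, h.apply_zero_lie_z hrank]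

theorem differential_one [Infinite K] :
    differential (A 1) = wedge (generatorForm A x y 0) (generatorForm A x y 2) := by
  ext u v
  rw [differential_apply, h.lie_eq hrank u v]
  simp [generatorForm, h.apply_one_lie_y hrank, h.apply_one_lie_z hrank]

theorem differential_two [Infinite K] :
    differential (A 2) = wedge (generatorForm A x y 1) (generatorForm A x y 2) := by
  ext u v
  rw [differential_apply, h.lie_eq hrank u v]
  simp [generatorForm, h.apply_two_lie_x hrank, h.apply_two_lie_y hrank,
    h.apply_two_lie_z hrank, sub_eq_add_neg]

theorem iso_n6_20 [Infinite K] (h2 : LieModule.lowerCentralSeries K L L 2 = ⊥) :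
    Iso K L (MCAlg K n6_20 × MCAlg K (abelian (finrank K L - 6))) := by
  have hclosed := differential_generatorForm h2 A x y
  refine iso_of_maurerCartan n6_20 (φ := ![generatorForm A x y 0, generatorForm A x y 1, A 0,
    generatorForm A x y 2, A 1, A 2]) (fun k => ?_) (fun c => ?_)
    fun w hw hφ => h.isDerivedCoordinates.eq_zero w hw fun i => ?_
  · fin_cases k
    all_goals simp [n6_20, hclosed, h.differential_zero hrank, h.differential_one hrank,
      h.differential_two hrank]
  · obtain ⟨u, hu, hu'⟩ := h.isDerivedCoordinates.exists_apply_eq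
      h.linearIndependent_generatorForm hclosed ![c 0, c 1, c 3] ![c 2, c 4, c 5]
    refine ⟨u, fun k => ?_⟩
    fin_cases k
    exacts [hu 0, hu 1, hu' 0, hu 2, hu' 1, hu' 2]
  · fin_cases i
    exacts [hφ 2, hφ 4, hφ 5]

end RankTwo

end IsFreeTriple

end FreeTriple

section JordanBlocks

variable {K : Type*} [Field K] {V : Type*} [AddCommGroup V] [Module K V] {T : End K V} {r m : ℕ}

theorem exists_basis_of_sq_eq_zero [FiniteDimensional K V] (hT : ∀ v, T (T v) = 0)
    (hr : finrank K T.range = r) (hm : finrank K V = 2 * r + m) :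
    ∃ b : Basis (Fin r ⊕ Fin r ⊕ Fin m) K V, (∀ i, T (b (.inl i)) = b (.inr (.inl i))) ∧
      ∀ k, T (b (.inr k)) = 0 := by
  have hle : T.range ≤ T.ker := by
    rintro _ ⟨v, rfl⟩
    exact hT v
  obtain ⟨P, hP⟩ := T.ker.exists_isCompl
  obtain ⟨Q, hQ⟩ := (T.range.submoduleOf T.ker).exists_isCompl
  have hker := LinearMap.finrank_range_add_finrank_ker T
  have hQm := Submodule.finrank_add_eq_of_isCompl hQ
  rw [(Submodule.submoduleOfEquivOfLe hle).finrank_eq] at hQm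
  let bR : Basis (Fin r) K T.range := finBasisOfFinrankEq K _ hr
  let bQ : Basis (Fin m) K Q := finBasisOfFinrankEq K _ (by omega)
  let bP : Basis (Fin r) K P := bR.map (T.kerComplementEquivRange hP.symm).symm
  let bker : Basis (Fin r ⊕ Fin m) K T.ker :=
    ((bR.map (Submodule.submoduleOfEquivOfLe hle).symm).prod bQ).map
      (Submodule.prodEquivOfIsCompl _ _ hQ)
  refine ⟨(bP.prod bker).map (Submodule.prodEquivOfIsCompl _ _ hP.symm), fun i => ?_, fun k => ?_⟩
  · have hbP : T (bP i) = bR i :=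
      congrArg Subtype.val ((T.kerComplementEquivRange hP.symm).apply_symm_apply (bR i))
    simpa [bker, Submodule.submoduleOfEquivOfLe] using hbP
  · simp

/-- The block sizes of a square-zero operator of rank `r` on a space of dimension `2 * r + m`. -/
def squareZeroBlocks (r m : ℕ) : List ℕ := List.replicate r 2 ++ List.replicate m 1

theorem length_squareZeroBlocks : (squareZeroBlocks r m).length = r + m := by
  simp [squareZeroBlocks]

theorem getElem_squareZeroBlocks {i : ℕ} (hi : i < (squareZeroBlocks r m).length) :
    (squareZeroBlocks r m)[i] = if i < r then 2 else 1 := by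
  simp [squareZeroBlocks, List.getElem_append]

theorem pairwise_squareZeroBlocks : (squareZeroBlocks r m).Pairwise fun a b => b ≤ a := by
  refine List.pairwise_append.2 ⟨List.pairwise_replicate.2 (.inr le_rfl),
    List.pairwise_replicate.2 (.inr le_rfl), fun a ha b hb => ?_⟩
  rw [List.eq_of_mem_replicate ha, List.eq_of_mem_replicate hb]
  exact one_le_two

theorem pos_of_mem_squareZeroBlocks {a : ℕ} (ha : a ∈ squareZeroBlocks r m) : 0 < a := by
  rcases List.mem_append.1 ha with ha | ha <;> rw [List.eq_of_mem_replicate ha] <;> norm_num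

/-- The position in a basis as in `exists_basis_of_sq_eq_zero` of the `j`-th vector of the `i`-th
Jordan block. -/
def blockPosition
    (p : Σ i : Fin (squareZeroBlocks r m).length, Fin ((squareZeroBlocks r m).get i)) :
    Fin r ⊕ Fin r ⊕ Fin m :=
  if hi : (p.1 : ℕ) < r then if (p.2 : ℕ) = 0 then .inl ⟨p.1, hi⟩ else .inr (.inl ⟨p.1, hi⟩)
  else .inr (.inr ⟨p.1 - r, by have := p.1.2.trans_eq length_squareZeroBlocks; omega⟩)

theorem blockPosition_bijective : Function.Bijective (blockPosition (r := r) (m := m)) := by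
  have hcard : Fintype.card (Σ i : Fin (squareZeroBlocks r m).length,
      Fin ((squareZeroBlocks r m).get i)) = Fintype.card (Fin r ⊕ Fin r ⊕ Fin m) := by
    rw [Fintype.card_sigma]
    simp only [Fintype.card_fin, Fintype.card_sum]
    rw [← List.sum_ofFn, List.ofFn_get]
    simp only [squareZeroBlocks, List.sum_append, List.sum_replicate, smul_eq_mul]
    omega
  refine (Fintype.bijective_iff_surjective_and_card _).2 ⟨?_, hcard⟩
  have hlen : (squareZeroBlocks r m).length = r + m := length_squareZeroBlocks
  rintro (i | i | i)
  · exact ⟨⟨⟨i, by omega⟩, ⟨0, by simp [getElem_squareZeroBlocks]⟩⟩, by simp [blockPosition]⟩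
  · exact ⟨⟨⟨i, by omega⟩, ⟨1, by simp [getElem_squareZeroBlocks]⟩⟩, by simp [blockPosition]⟩
  · exact ⟨⟨⟨r + i, by omega⟩, ⟨0, by simp [getElem_squareZeroBlocks]⟩⟩, by simp [blockPosition]⟩

theorem hasJordanBlocks_of_sq_eq_zero [FiniteDimensional K V] (hT : ∀ v, T (T v) = 0)
    (hr : finrank K T.range = r) (hm : finrank K V = 2 * r + m) :
    HasJordanBlocks T (squareZeroBlocks r m) := by
  obtain ⟨b, hb, hb'⟩ := exists_basis_of_sq_eq_zero hT hr hm
  refine ⟨pairwise_squareZeroBlocks, fun a => pos_of_mem_squareZeroBlocks,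
    b.reindex (Equiv.ofBijective _ blockPosition_bijective).symm, fun i j => ?_⟩
  have hj := j.2.trans_eq (getElem_squareZeroBlocks i.2)
  simp only [Basis.reindex_apply, Equiv.symm_symm, Equiv.ofBijective_apply, List.get_eq_getElem,
    getElem_squareZeroBlocks]
  by_cases hi : (i : ℕ) < r
  · by_cases hj0 : (j : ℕ) = 0
    · simp [blockPosition, hi, hj0, hb]
    · rw [dif_neg (by grind)]
      simp [blockPosition, hi, hj0, hb']
  · rw [dif_neg (by grind)]
    simp [blockPosition, hi, hb']

theorem HasJordanBlocks.exists_linearIndependent {l : List ℕ}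
    (h : HasJordanBlocks T (2 :: 2 :: l)) : ∃ v w, LinearIndependent K ![T v, T w] := by
  obtain ⟨-, -, b, hb⟩ := h
  let i₀ : Fin (2 :: 2 :: l).length := ⟨0, by simp⟩
  let i₁ : Fin (2 :: 2 :: l).length := ⟨1, by simp⟩
  have h₀ : T (b ⟨i₀, ⟨0, two_pos⟩⟩) = b ⟨i₀, ⟨1, one_lt_two⟩⟩ := hb i₀ ⟨0, two_pos⟩
  have h₁ : T (b ⟨i₁, ⟨0, two_pos⟩⟩) = b ⟨i₁, ⟨1, one_lt_two⟩⟩ := hb i₁ ⟨0, two_pos⟩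
  refine ⟨b ⟨i₀, ⟨0, two_pos⟩⟩, b ⟨i₁, ⟨0, two_pos⟩⟩, ?_⟩
  have hne : (⟨i₀, ⟨1, one_lt_two⟩⟩ : Σ i, Fin ((2 :: 2 :: l).get i)) ≠ ⟨i₁, ⟨1, one_lt_two⟩⟩ :=
    fun h => absurd (congrArg (fun p => (p.1 : ℕ)) h) zero_ne_one
  have hcomp : b ∘ ![⟨i₀, ⟨1, one_lt_two⟩⟩, ⟨i₁, ⟨1, one_lt_two⟩⟩] =
      ![b ⟨i₀, ⟨1, one_lt_two⟩⟩, b ⟨i₁, ⟨1, one_lt_two⟩⟩] :=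
    funext (Fin.forall_fin_two.2 ⟨rfl, rfl⟩)
  rw [h₀, h₁, ← hcomp]
  exact b.linearIndependent.comp _ (injective_pair_iff_ne.2 hne)

end JordanBlocks

section CharacteristicSequence

variable {K : Type*} [Field K] {L : Type*} [LieRing L] [LieAlgebra K L]

theorem squareZeroBlocks_add_three_not_le (r m n : ℕ) :
    ¬ squareZeroBlocks (r + 3) m ≤ 2 :: 2 :: List.replicate n 1 := by
  refine not_le.2 ?_
  simp only [squareZeroBlocks, List.replicate_succ, List.cons_append]
  refine .cons (.cons ?_)
  cases n with
  | zero => exact .nil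
  | succ n => exact .rel one_lt_two

theorem IsCharacteristicSequence.finrank_range_ad_le [FiniteDimensional K L]
    (h2 : LieModule.lowerCentralSeries K L L 2 = ⊥) {m : ℕ}
    (h : IsCharacteristicSequence K L (2 :: 2 :: List.replicate m 1)) (x : L) :
    finrank K (LieAlgebra.ad K L x).range ≤ 2 := by
  by_contra! hlt
  have hsq (v : L) : LieAlgebra.ad K L x (LieAlgebra.ad K L x v) = 0 :=
    lie_eq_zero_of_mem_derivedAlgebra h2 x (lie_mem_derivedAlgebra K x v)
  have hx : x ∉ LieModule.lowerCentralSeries K L L 1 := fun hx => by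
    have had : LieAlgebra.ad K L x = 0 := by
      ext v
      rw [LieAlgebra.ad_apply, ← lie_skew, lie_eq_zero_of_mem_derivedAlgebra h2 v hx, neg_zero,
        LinearMap.zero_apply]
    rw [had, LinearMap.range_zero, finrank_bot] at hlt
    omega
  have hle : finrank K (LieAlgebra.ad K L x).range ≤ finrank K (LieAlgebra.ad K L x).ker :=
    Submodule.finrank_mono (by rintro _ ⟨v, rfl⟩; exact hsq v)
  have hsum := LinearMap.finrank_range_add_finrank_ker (LieAlgebra.ad K L x)
  obtain ⟨r, hr⟩ := Nat.exists_eq_add_of_lt hlt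
  exact squareZeroBlocks_add_three_not_le r (finrank K L - 2 * (r + 3)) m
    (h.2 ⟨x, hx, hasJordanBlocks_of_sq_eq_zero hsq (hr.trans (by omega)) (by omega)⟩)

end CharacteristicSequence

section Classification

variable {K : Type*} [Field K] {L : Type*} [LieRing L] [LieAlgebra K L]

theorem finrank_derivedAlgebra_eq_two [Infinite K] [FiniteDimensional K L]
    (hrank : ∀ u : L, finrank K (LieAlgebra.ad K L u).range ≤ 2) {x y z : L}
    (hli : LinearIndependent K ![⁅x, y⁆, ⁅x, z⁆])
    (hyz : ⁅y, z⁆ ∈ Submodule.span K {⁅x, y⁆, ⁅x, z⁆}) :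
    finrank K (derivedAlgebra K L) = 2 := by
  have hle : (derivedAlgebra K L).toSubmodule ≤ Submodule.span K {⁅x, y⁆, ⁅x, z⁆} :=
    derivedAlgebra_le_of_lie_mem hrank hli (Submodule.mem_span_of_mem (by simp))
      (Submodule.mem_span_of_mem (by simp)) hyz
  have hge : Submodule.span K {⁅x, y⁆, ⁅x, z⁆} ≤ (derivedAlgebra K L).toSubmodule :=
    Submodule.span_le.2 (Set.pair_subset_iff.2
      ⟨lie_mem_derivedAlgebra K x y, lie_mem_derivedAlgebra K x z⟩)
  exact (congrArg (fun W : Submodule K L => finrank K W) (hle.antisymm hge)).trans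
    (finrank_span_pair hli)

theorem iso_n6_20_of_lie_notMem [Infinite K] [FiniteDimensional K L]
    (h2 : LieModule.lowerCentralSeries K L L 2 = ⊥)
    (hrank : ∀ u : L, finrank K (LieAlgebra.ad K L u).range ≤ 2) {x y z : L}
    (hli : LinearIndependent K ![⁅x, y⁆, ⁅x, z⁆])
    (hyz : ⁅y, z⁆ ∉ Submodule.span K {⁅x, y⁆, ⁅x, z⁆}) :
    Iso K L (MCAlg K n6_20 × MCAlg K (abelian (finrank K L - 6))) := by
  have hli3 : LinearIndependent K ![⁅x, y⁆, ⁅x, z⁆, ⁅y, z⁆] := by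
    rw [← Matrix.range_cons_cons_empty _ _ ![]] at hyz
    have hsnoc : (Fin.snoc ![⁅x, y⁆, ⁅x, z⁆] ⁅y, z⁆ : Fin 3 → L) = ![⁅x, y⁆, ⁅x, z⁆, ⁅y, z⁆] :=
      funext (Fin.forall_fin_succ.2 ⟨rfl, Fin.forall_fin_two.2 ⟨rfl, rfl⟩⟩)
    exact hsnoc ▸ linearIndependent_finSnoc.2 ⟨hli, hyz⟩
  have hmem (i : Fin 3) : ![⁅x, y⁆, ⁅x, z⁆, ⁅y, z⁆] i ∈
      Submodule.span K (Set.range ![⁅x, y⁆, ⁅x, z⁆, ⁅y, z⁆]) := Submodule.mem_span_of_mem ⟨i, rfl⟩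
  obtain ⟨A, hA⟩ := exists_isFreeTriple hli3
    (derivedAlgebra_le_of_lie_mem hrank hli (hmem 0) (hmem 1) (hmem 2))
  exact hA.iso_n6_20 hrank h2

theorem iso_of_finrank_range_ad_le [Infinite K] [NeZero (2 : K)] [FiniteDimensional K L]
    (hK : ∀ d : K, IsSquare d ∨ IsSquare (-d)) (hs : IsSymplectic K L)
    (h2 : LieModule.lowerCentralSeries K L L 2 = ⊥)
    (hrank : ∀ u : L, finrank K (LieAlgebra.ad K L u).range ≤ 2) {x y z : L}
    (hli : LinearIndependent K ![⁅x, y⁆, ⁅x, z⁆]) :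
    Iso K L (MCAlg K n7_124 × MCAlg K (abelian (finrank K L - 7))) ∨
      Iso K L (MCAlg K n6_19 × MCAlg K (abelian (finrank K L - 6))) ∨
      Iso K L (MCAlg K n6_20 × MCAlg K (abelian (finrank K L - 6))) ∨
      Iso K L (MCAlg K n5_5 × MCAlg K (abelian (finrank K L - 5))) ∨
      Iso K L ((MCAlg K n3_1 × MCAlg K n3_1) × MCAlg K (abelian (finrank K L - 6))) ∨
      (¬IsSquare (-1 : K) ∧
        Iso K L (MCAlg K n6_20_1 × MCAlg K (abelian (finrank K L - 6)))) := by
  by_cases hyz : ⁅y, z⁆ ∈ Submodule.span K {⁅x, y⁆, ⁅x, z⁆}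
  · obtain ⟨A, α, β, μ, ν, ρ, h⟩ :=
      hs.exists_isPencil h2 (finrank_derivedAlgebra_eq_two hrank hli hyz)
    have := h.iso hK
    tauto
  · exact .inr (.inr (.inl (iso_n6_20_of_lie_notMem h2 hrank hli hyz)))

theorem mainTheorem3_general [Infinite K] [NeZero (2 : K)]
    (hK : ∀ d : K, IsSquare d ∨ IsSquare (-d)) (hdim : 7 < finrank K L) (hs : IsSymplectic K L)
    (h2 : LieModule.lowerCentralSeries K L L 2 = ⊥) {m : ℕ}
    (hcs : IsCharacteristicSequence K L (2 :: 2 :: List.replicate m 1)) :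
    IsDecomposable K L ∧
      (Iso K L (MCAlg K n7_124 × MCAlg K (abelian (finrank K L - 7))) ∨
        Iso K L (MCAlg K n6_19 × MCAlg K (abelian (finrank K L - 6))) ∨
        Iso K L (MCAlg K n6_20 × MCAlg K (abelian (finrank K L - 6))) ∨
        Iso K L (MCAlg K n5_5 × MCAlg K (abelian (finrank K L - 5))) ∨
        Iso K L ((MCAlg K n3_1 × MCAlg K n3_1) × MCAlg K (abelian (finrank K L - 6))) ∨
        (¬IsSquare (-1 : K) ∧
          Iso K L (MCAlg K n6_20_1 × MCAlg K (abelian (finrank K L - 6))))) := by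
  have : FiniteDimensional K L := Module.finite_of_finrank_pos (by omega)
  have : NeZero (finrank K L - 7) := ⟨by omega⟩
  have : NeZero (finrank K L - 6) := ⟨by omega⟩
  have : NeZero (finrank K L - 5) := ⟨by omega⟩
  obtain ⟨x, -, hx⟩ := hcs.1
  obtain ⟨y, z, hli⟩ := hx.exists_linearIndependent
  have hiso := iso_of_finrank_range_ad_le hK hs h2 (hcs.finrank_range_ad_le h2) hli
  refine ⟨?_, hiso⟩
  rcases hiso with h | h | h | h | h | ⟨-, h⟩ <;> exact isDecomposable_of_iso_prod h

end Classification

end SymplecticTwoStep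

open SymplecticTwoStep in
theorem mainTheorem3 (p : ℕ) (hp : 4 ≤ p) :
    (∀ (g : Type*) [LieRing g] [LieAlgebra ℂ g],
      Module.finrank ℂ g = 2 * p → IsSymplectic ℂ g → IsTwoStepNilpotent ℂ g →
      IsCharacteristicSequence ℂ g (2 :: 2 :: List.replicate (2 * p - 4) 1) →
      IsDecomposable ℂ g ∧
        (Iso ℂ g (MCAlg ℂ n7_124 × MCAlg ℂ (abelian (2 * p - 7))) ∨
         Iso ℂ g (MCAlg ℂ n6_19 × MCAlg ℂ (abelian (2 * p - 6))) ∨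
         Iso ℂ g (MCAlg ℂ n6_20 × MCAlg ℂ (abelian (2 * p - 6))) ∨
         Iso ℂ g (MCAlg ℂ n5_5 × MCAlg ℂ (abelian (2 * p - 5))) ∨
         Iso ℂ g ((MCAlg ℂ n3_1 × MCAlg ℂ n3_1) × MCAlg ℂ (abelian (2 * p - 6))))) ∧
    (∀ (g : Type*) [LieRing g] [LieAlgebra ℝ g],
      Module.finrank ℝ g = 2 * p → IsSymplectic ℝ g → IsTwoStepNilpotent ℝ g →
      IsCharacteristicSequence ℝ g (2 :: 2 :: List.replicate (2 * p - 4) 1) →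
      IsDecomposable ℝ g ∧
        (Iso ℝ g (MCAlg ℝ n7_124 × MCAlg ℝ (abelian (2 * p - 7))) ∨
         Iso ℝ g (MCAlg ℝ n6_19 × MCAlg ℝ (abelian (2 * p - 6))) ∨
         Iso ℝ g (MCAlg ℝ n6_20 × MCAlg ℝ (abelian (2 * p - 6))) ∨
         Iso ℝ g (MCAlg ℝ n5_5 × MCAlg ℝ (abelian (2 * p - 5))) ∨
         Iso ℝ g ((MCAlg ℝ n3_1 × MCAlg ℝ n3_1) × MCAlg ℝ (abelian (2 * p - 6))) ∨
         Iso ℝ g (MCAlg ℝ n6_20_1 × MCAlg ℝ (abelian (2 * p - 6))))) := by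
  refine ⟨fun g _ _ hdim hs h2 hcs => ?_, fun g _ _ hdim hs h2 hcs => ?_⟩
  · have hsq (d : ℂ) : IsSquare d := IsAlgClosed.exists_eq_mul_self d
    obtain ⟨hdec, hiso⟩ := mainTheorem3_general (fun d => .inl (hsq d)) (by omega) hs h2.1 hcs
    rw [hdim] at hiso
    have := hsq (-1)
    exact ⟨hdec, by tauto⟩
  · have hsq (d : ℝ) : IsSquare d ∨ IsSquare (-d) := by
      rw [Real.isSquare_iff, Real.isSquare_iff, Left.nonneg_neg_iff]
      exact le_total 0 d
    obtain ⟨hdec, hiso⟩ := mainTheorem3_general hsq (by omega) hs h2.1 hcs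
    rw [hdim] at hiso
    exact ⟨hdec, by tauto⟩
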